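/- Let $K$ be a field and $X$ a finite connected poset with $|X|>1$; fix a base point $x_0\in X$. Let $I(X,K)$ be the incidence algebra, with standard basis $e_{xy}$ ($x\le y$) and $e_x:=e_{xx}$; let $D(X,K)$ be the span of the $e_x$, let $X^2_<=\{(x,y):x<y\}$ and $\mathcal B=\{e_{xy}:x<y\}$. Write $[a,b]=ab-ba$. **Preservers.** A linear map $\varphi:I(X,K)\to I(X,K)$ is a *strong commutativity preserver* if $[a,b]=0\iff[\varphi(a),\varphi(b)]=0$ for all $a,b$, and a *diagonality preserver* if $\varphi(D(X,K))\subseteq D(X,K)$. A strong commutativity preserver $\varphi$ is *of Lie type* if $\varphi=k\psi+\xi$, where $k\in K\setminus\{0\}$, $\psi$ is a Lie automorphism of $I(X,K)$ and $\xi$ is a linear map with values in the center of $I(X,K)$. **Shift type.** For a linear map $\alpha:I(X,K)\to D(X,K)$ put $S_\alpha(f)=f+\alpha(f)$. Then $S_\alpha$ is *of shift type* if it is a strong commutativity preserver and - $[\alpha(e_{xy}),e_{uv}]=0$ for all $e_{xy}\neq e_{uv}$ in $\mathcal B$; - $[\alpha(e_z),e_{xy}]=0$ for all $e_{xy}\in\mathcal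 B$ and $z$ such that $z\notin\{x,y\}$ or $y$ does not cover $x$; - $[\alpha(e_x),e_{xy}]=[e_{xy},\alpha(e_y)]$ and $[\alpha(e_x),e_{xy}]\neq-e_{xy}$ whenever $y$ covers $x$. **The maps $\tau_{\theta,\sigma,c,\kappa}$.** Let $\theta:\mathcal B\to\mathcal B$ be a bijection, $\sigma,c:X^2_<\to K^*$ and $\kappa:X\to K$, such that: 1. $\theta$ is monotone on maximal chains: for every maximal chain $u_1<\dots<u_m$ there is a maximal chain $v_1<\dots<v_m$ with $\theta(e_{u_iu_j})=e_{v_iv_j}$ for all $i<j$, or with $\theta(e_{u_iu_j})=e_{v_{m-j+1}v_{m-i+1}}$ for all $i<j$; 2. $\sigma$ is $c$-compatible with $\theta$: for all $x<y<z$, if $\theta(e_{xz})=\theta(e_{xy})\theta(e_{yz})$ then $c(x,z)\sigma(x,z)=\sigma(x,y)\sigma(y,z)$, and if $\theta(e_{xz})=\theta(e_{yz})\theta(e_{xy})$ then $c(x,z)\sigma(x,z)=-\sigma(x,y)\sigma(y,z)$; 3. $c$ is constant on maximal chains: $c(u_i,u_j)=c(u_1,u_m)$ for all $i<j$ and every maximal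 chain $u_1<\dots<u_m$; 4. $(\theta,c)$ is admissible: $\sum_{i=0}^{m-1}\Delta_z(u_i,u_{i+1})=0$ for every $z\in X$ and every closed walk $u_0,\dots,u_m=u_0$ in the Hasse diagram of $X$. Here, for $u<v$ with $e_{uv}=\theta(e_{ab})$, $\Delta_z(u,v)=-\Delta_z(v,u)$ equals $-c(a,b)$ if $z=a$, $c(a,b)$ if $z=b$, and $0$ otherwise; 5. $\sum_{z\in X}\kappa(z)\neq0$. Then $\tau=\tau_{\theta,\sigma,c,\kappa}$ is the linear map with $\tau(e_{xy})=\sigma(x,y)\theta(e_{xy})$ for $x<y$ and $\tau(e_z)=\sum_{v\in X}\tau(e_z)(v,v)e_v$, where $\tau(e_z)(v,v)=\kappa(z)+\sum_{i=0}^{m-1}\Delta_z(u_i,u_{i+1})$ for any walk $x_0=u_0,u_1,\dots,u_m=v$ in the Hasse diagram (by 4, the choice of the walk is irrelevant). **Proposition.** Let $\varphi:I(X,K)\to I(X,K)$ be a bijective strong commutativity and diagonality preserver. (i) $\varphi$ is of Lie type if and only if $\varphi=S_\alpha\circ\tau_{\theta,\sigma,c,\kappa}$ for some $S_\alpha$ of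 shift type and some $(\theta,\sigma,c,\kappa)$ as above such that $\alpha$ takes values in the center of $I(X,K)$ and $c$ is constant on $X^2_<$. (ii) If $\varphi=S_\alpha\circ\tau_{\theta,\sigma,c,\kappa}$ is any decomposition with $S_\alpha$ of shift type, $(\theta,\sigma,c,\kappa)$ as above and $\alpha|_{D(X,K)}=0$, then $\varphi$ is of Lie type if and only if $\alpha$ takes values in the center of $I(X,K)$ and $c$ is constant on $X^2_<$. -/

import Mathlib

noncomputable section

namespace CommPres

/-! ### Commutativity preservers of associative algebras -/

section General

variable {K A : Type*} [Field K] [Ring A] [Algebra K A]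

/-- `φ` preserves commutativity in both directions: `[a, b] = 0` if and only if
`[φ a, φ b] = 0`. -/
def IsStrongCommPreserver (φ : A →ₗ[K] A) : Prop :=
  ∀ a b : A, ⁅a, b⁆ = 0 ↔ ⁅φ a, φ b⁆ = 0

attribute [local instance 100] LieRing.ofAssociativeRing

/-- A strong commutativity preserver is of Lie type if it is the sum of a non-zero scalar
multiple of a Lie automorphism and a linear central-valued map. -/
def IsOfLieType (φ : A →ₗ[K] A) : Prop :=
  IsStrongCommPreserver φ ∧
    ∃ (k : K) (ψ : A ≃ₗ⁅K⁆ A) (ξ : A →ₗ[K] A),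
      k ≠ 0 ∧ (∀ a, ξ a ∈ Subalgebra.center K A) ∧ ∀ a, φ a = k • ψ a + ξ a

end General

/-! ### Incidence algebras -/

/-- The set `X²_<` of pairs `(x, y)` with `x < y`. It also serves as the index set of the
basis `𝓑 = {e_{xy} : x < y}` of the Jacobson radical: a bijection `θ : 𝓑 → 𝓑` is written as a
permutation of `LtPair X`, via `e_{xy} ↔ (x, y)`. -/
abbrev LtPair (X : Type*) [Preorder X] : Type _ := {p : X × X // p.1 < p.2}

section Basis

variable (K : Type*) {X : Type*} [Field K] [PartialOrder X] [DecidableEq X]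

/-- The standard basis element `e_{xy}`, `x ≤ y`. -/
def stdBasis (x y : X) (h : x ≤ y) : IncidenceAlgebra K X where
  toFun u v := if u = x ∧ v = y then 1 else 0
  eq_zero_of_not_le' u v huv := by
    rw [if_neg]
    rintro ⟨rfl, rfl⟩
    exact huv h

/-- The diagonal basis element `e_x = e_{xx}`. -/
def eD (x : X) : IncidenceAlgebra K X := stdBasis K x x le_rfl

/-- The radical basis element `e_{xy}`, `x < y`. -/
def eB (p : LtPair X) : IncidenceAlgebra K X := stdBasis K p.1.1 p.1.2 p.2.le

end Basis

/-- The space `D(X, K)` of diagonal elements. -/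
def diagonal (K X : Type*) [Field K] [PartialOrder X] :
    Submodule K (IncidenceAlgebra K X) where
  carrier := {f | ∀ x y, x ≠ y → f x y = 0}
  zero_mem' := fun _ _ _ => rfl
  add_mem' := by
    intro f g hf hg x y h
    rw [IncidenceAlgebra.add_apply, hf x y h, hg x y h, add_zero]
  smul_mem' := by
    intro k f hf x y h
    rw [IncidenceAlgebra.constSMul_apply, hf x y h, smul_zero]

section Shift

variable {K X : Type*} [Field K] [PartialOrder X]

/-- `φ` maps diagonal elements to diagonal elements. -/
def IsDiagonalityPreserver (φ : IncidenceAlgebra K X →ₗ[K] IncidenceAlgebra K X) : Prop :=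
  ∀ f ∈ diagonal K X, φ f ∈ diagonal K X

/-- The map `S_α (f) = f + α (f)`. -/
def shift (α : IncidenceAlgebra K X →ₗ[K] diagonal K X) :
    IncidenceAlgebra K X →ₗ[K] IncidenceAlgebra K X :=
  LinearMap.id + (diagonal K X).subtype ∘ₗ α

variable [LocallyFiniteOrder X] [DecidableEq X]

/-- `S_α` is a commutativity preserver of shift type. The interval `⌊x, y⌋` has length one
exactly when `y` covers `x`. -/
structure IsOfShiftType (α : IncidenceAlgebra K X →ₗ[K] diagonal K X) : Prop where
  strong : IsStrongCommPreserver (shift α)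
  bracket_eB : ∀ p q : LtPair X, p ≠ q →
    ⁅(α (eB K p) : IncidenceAlgebra K X), eB K q⁆ = 0
  bracket_eD : ∀ (z : X) (p : LtPair X), (z ≠ p.1.1 ∧ z ≠ p.1.2) ∨ ¬ p.1.1 ⋖ p.1.2 →
    ⁅(α (eD K z) : IncidenceAlgebra K X), eB K p⁆ = 0
  bracket_comm : ∀ p : LtPair X, p.1.1 ⋖ p.1.2 →
    ⁅(α (eD K p.1.1) : IncidenceAlgebra K X), eB K p⁆ =
      ⁅eB K p, (α (eD K p.1.2) : IncidenceAlgebra K X)⁆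
  bracket_ne : ∀ p : LtPair X, p.1.1 ⋖ p.1.2 →
    ⁅(α (eD K p.1.1) : IncidenceAlgebra K X), eB K p⁆ ≠ -eB K p

/-- `α` takes values in the center of `I(X, K)`. -/
def IsCentralValued (α : IncidenceAlgebra K X →ₗ[K] diagonal K X) : Prop :=
  ∀ f, (α f : IncidenceAlgebra K X) ∈ Subalgebra.center K (IncidenceAlgebra K X)

end Shift

/-! ### The data `(θ, σ, c, κ)` -/

section MaximalChains

variable {X : Type*} [PartialOrder X]

/-- The strictly increasing sequence `u` enumerates a maximal chain of `X`. -/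
def IsMaximalChain {m : ℕ} (u : Fin m → X) : Prop :=
  StrictMono u ∧ IsMaxChain (· ≤ ·) (Set.range u)

/-- `θ` is increasing on the maximal chain `u`. -/
def IsIncreasingOn (θ : Equiv.Perm (LtPair X)) {m : ℕ} (u : Fin m → X)
    (hu : IsMaximalChain u) : Prop :=
  ∃ v : Fin m → X, IsMaximalChain v ∧
    ∀ (i j : Fin m) (h : i < j), (θ ⟨(u i, u j), hu.1 h⟩ : X × X) = (v i, v j)

/-- `θ` is decreasing on the maximal chain `u`. -/
def IsDecreasingOn (θ : Equiv.Perm (LtPair X)) {m : ℕ} (u : Fin m → X)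
    (hu : IsMaximalChain u) : Prop :=
  ∃ v : Fin m → X, IsMaximalChain v ∧
    ∀ (i j : Fin m) (h : i < j), (θ ⟨(u i, u j), hu.1 h⟩ : X × X) = (v j.rev, v i.rev)

/-- `θ` is monotone on maximal chains in `X`. -/
def IsMonotoneOnMaxChains (θ : Equiv.Perm (LtPair X)) : Prop :=
  ∀ (m : ℕ) (u : Fin m → X) (hu : IsMaximalChain u),
    IsIncreasingOn θ u hu ∨ IsDecreasingOn θ u hu

variable {K : Type*} [Field K]

/-- `c` is constant on maximal chains: `c(x_i, x_j) = c(x_1, x_m)` for all `i < j`, whenever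
`x_1 < ⋯ < x_m` is a maximal chain (only chains with at least two elements matter). -/
def IsConstantOnMaxChains (c : LtPair X → Kˣ) : Prop :=
  ∀ (m : ℕ) (u : Fin (m + 2) → X) (hu : IsMaximalChain u) (i j : Fin (m + 2)) (h : i < j),
    c ⟨(u i, u j), hu.1 h⟩ =
      c ⟨(u 0, u (Fin.last (m + 1))), hu.1 (Fin.last_pos)⟩

/-- `σ` is `c`-compatible with `θ`. -/
def IsCompatible [LocallyFiniteOrder X] [DecidableEq X] (θ : Equiv.Perm (LtPair X))
    (σ c : LtPair X → Kˣ) : Prop :=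
  ∀ (x y z : X) (hxy : x < y) (hyz : y < z),
    (eB K (θ ⟨(x, z), hxy.trans hyz⟩) =
        eB K (θ ⟨(x, y), hxy⟩) * eB K (θ ⟨(y, z), hyz⟩) →
      (c ⟨(x, z), hxy.trans hyz⟩ * σ ⟨(x, z), hxy.trans hyz⟩ : K) =
        σ ⟨(x, y), hxy⟩ * σ ⟨(y, z), hyz⟩) ∧
    (eB K (θ ⟨(x, z), hxy.trans hyz⟩) =
        eB K (θ ⟨(y, z), hyz⟩) * eB K (θ ⟨(x, y), hxy⟩) →
      (c ⟨(x, z), hxy.trans hyz⟩ * σ ⟨(x, z), hxy.trans hyz⟩ : K) =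
        -(σ ⟨(x, y), hxy⟩ * σ ⟨(y, z), hyz⟩))

end MaximalChains

/-! Walks in `X` are the walks of the Hasse diagram: consecutive members are comparable and
the interval between them has length one. -/

section Walks

variable {K X : Type*} [Field K] [PartialOrder X] [DecidableEq X]

open Classical in
/-- `c(z, w)` if `u < v` and `θ(e_{zw}) = e_{uv}` for some (necessarily unique) `w > z`;
zero otherwise. -/
def lowerTerm (θ : Equiv.Perm (LtPair X)) (c : LtPair X → Kˣ) (z u v : X) : K :=
  if h : u < v then
    if (θ.symm ⟨(u, v), h⟩).1.1 = z then (c (θ.symm ⟨(u, v), h⟩) : K) else 0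
  else 0

open Classical in
/-- `c(w, z)` if `u < v` and `θ(e_{wz}) = e_{uv}` for some (necessarily unique) `w < z`;
zero otherwise. -/
def upperTerm (θ : Equiv.Perm (LtPair X)) (c : LtPair X → Kˣ) (z u v : X) : K :=
  if h : u < v then
    if (θ.symm ⟨(u, v), h⟩).1.2 = z then (c (θ.symm ⟨(u, v), h⟩) : K) else 0
  else 0

variable (θ : Equiv.Perm (LtPair X)) (c : LtPair X → Kˣ)

/-- `s⁺_{θ,c,Γ}(z)` -/
def sPlus {a b : X} (Γ : (SimpleGraph.hasse X).Walk a b) (z : X) : K :=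
  ∑ i ∈ Finset.range Γ.length, lowerTerm θ c z (Γ.getVert i) (Γ.getVert (i + 1))

/-- `s⁻_{θ,c,Γ}(z)` -/
def sMinus {a b : X} (Γ : (SimpleGraph.hasse X).Walk a b) (z : X) : K :=
  ∑ i ∈ Finset.range Γ.length, lowerTerm θ c z (Γ.getVert (i + 1)) (Γ.getVert i)

/-- `t⁺_{θ,c,Γ}(z)` -/
def tPlus {a b : X} (Γ : (SimpleGraph.hasse X).Walk a b) (z : X) : K :=
  ∑ i ∈ Finset.range Γ.length, upperTerm θ c z (Γ.getVert i) (Γ.getVert (i + 1))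

/-- `t⁻_{θ,c,Γ}(z)` -/
def tMinus {a b : X} (Γ : (SimpleGraph.hasse X).Walk a b) (z : X) : K :=
  ∑ i ∈ Finset.range Γ.length, upperTerm θ c z (Γ.getVert (i + 1)) (Γ.getVert i)

/-- The pair `(θ, c)` is admissible: `s⁺ - s⁻ = t⁺ - t⁻` on every closed walk. -/
def IsAdmissible : Prop :=
  ∀ (a : X) (Γ : (SimpleGraph.hasse X).Walk a a) (z : X),
    sPlus θ c Γ z - sMinus θ c Γ z = tPlus θ c Γ z - tMinus θ c Γ z

/-- The conditions on a quadruple `(θ, σ, c, κ)` under which `τ_{θ,σ,c,κ}` is defined. -/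
structure IsTauData [Fintype X] [LocallyFiniteOrder X] (θ : Equiv.Perm (LtPair X))
    (σ c : LtPair X → Kˣ) (κ : X → K) : Prop where
  monotone : IsMonotoneOnMaxChains θ
  compatible : IsCompatible θ σ c
  constant : IsConstantOnMaxChains c
  admissible : IsAdmissible θ c
  sum_ne_zero : ∑ z, κ z ≠ 0

/-- The diagonal coefficient `τ(e_z)(v, v)` of `τ = τ_{θ,σ,c,κ}`: start with
`τ(e_z)(x₀, x₀) = κ z` and go from `x₀` to `v` along a walk `x₀ = u_0, …, u_m = v`. The increment
`τ(e_z)(u_{i+1}, u_{i+1}) - τ(e_z)(u_i, u_i)` over an ascending step with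
`e_{u_i u_{i+1}} = θ(e_{ab})` is `-c(a,b)` if `z = a`, `c(a,b)` if `z = b` and zero otherwise, and
it has the opposite sign over a descending step. For admissible `(θ, c)` the result does not
depend on the walk. -/
def tauDiag (hX : (SimpleGraph.hasse X).Connected) (x₀ : X) (θ : Equiv.Perm (LtPair X))
    (c : LtPair X → Kˣ) (κ : X → K) (z v : X) : K :=
  let Γ : (SimpleGraph.hasse X).Walk x₀ v := (hX.preconnected x₀ v).some
  κ z + (-sPlus θ c Γ z + sMinus θ c Γ z + tPlus θ c Γ z - tMinus θ c Γ z)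

/-- The map `τ_{θ,σ,c,κ}`, with base point `x₀`: it sends `e_{xy}` to `σ(x,y) θ(e_{xy})` for
`x < y`, and `e_z` to the diagonal element with entries `tauDiag`. -/
def tau [Fintype X] (hX : (SimpleGraph.hasse X).Connected) (x₀ : X)
    (θ : Equiv.Perm (LtPair X)) (σ c : LtPair X → Kˣ) (κ : X → K) :
    IncidenceAlgebra K X →ₗ[K] IncidenceAlgebra K X :=
  letI : Fintype (LtPair X) := Fintype.ofFinite _
  { toFun := fun f =>
      (∑ p : LtPair X, f p.1.1 p.1.2 • ((σ p : K) • eB K (θ p))) +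
        ∑ z : X, f z z • ∑ v : X, tauDiag hX x₀ θ c κ z v • eD K v
    map_add' := by
      intro f g
      simp only [IncidenceAlgebra.add_apply, add_smul, Finset.sum_add_distrib]
      abel
    map_smul' := by
      intro k f
      simp only [IncidenceAlgebra.constSMul_apply, smul_eq_mul, mul_smul, Finset.smul_sum,
        smul_add, RingHom.id_apply] }

end Walks

end CommPres

end

set_option linter.unusedSectionVars false

/-! The diagonal `D` acts on the incidence algebra by brackets, and `e_{xy}` with `x < y` is a
vector of weight `f ↦ f(x,x) - f(y,y)`. These weights are non-zero and pairwise distinct, in every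
characteristic.

Let `φ = kψ + ξ` be of Lie type. Central elements are diagonal, so `ψ` preserves `D` and maps it
onto itself; hence `ψ` permutes the weight lines: `ψ(e_p)` is a multiple of `e_{θ(p)}`, and the
weight of `ψ(f)` at `θ(p)` is that of `f` at `p` (`exists_perm_of_lieEquiv`). Applying `ψ` to
`[e_{xy}, e_{yz}] = e_{xz}` shows that `θ` carries compositions to compositions, in one of the two
orders, and yields the compatible scalars. The same holds for `θ⁻¹`, and together these make `θ`
monotone on maximal chains (`isMonotoneOnMaxChains_of_respectsComp`). The weight identity says that
the diagonal of `φ(e_z)` is a potential for the increments with `c = k`; this gives admissibility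
and recovers `τ` on `D`. What remains of `ξ` on the radical is absorbed into a central `α`
(`IsOfLieType.exists_decomposition`).

Conversely, if `c = k` throughout, then `[τ(f), τ(g)] = k τ([f, g])` (`tau_bracket`), so `k⁻¹τ` is a
Lie automorphism and `α ∘ τ` is the central summand.

For a given decomposition with `α` zero on `D`, the off-diagonal entries of `φ(e_p)` identify `θ`.
Their diagonal part then shows that `α` is central, and the diagonals of the `φ(e_z)` show that `c =
k` (`IsOfLieType.central_and_constant`). -/

namespace CommPres

/-! ### Compositions of pairs and maximal chains. -/

section Chains

variable {X Y : Type*} [PartialOrder X] [PartialOrder Y]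

/-- A map on pairs `x < y` respects composition if the image of `(x, z)` is the composite, in one
of the two possible orders, of the images of `(x, y)` and `(y, z)`. -/
def RespectsComp (θ : LtPair X → LtPair Y) : Prop :=
  ∀ (x y z : X) (hxy : x < y) (hyz : y < z),
    ((θ ⟨(x, y), hxy⟩).1.2 = (θ ⟨(y, z), hyz⟩).1.1 ∧
      (θ ⟨(x, z), hxy.trans hyz⟩).1 = ((θ ⟨(x, y), hxy⟩).1.1, (θ ⟨(y, z), hyz⟩).1.2)) ∨
    ((θ ⟨(y, z), hyz⟩).1.2 = (θ ⟨(x, y), hxy⟩).1.1 ∧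
      (θ ⟨(x, z), hxy.trans hyz⟩).1 = ((θ ⟨(y, z), hyz⟩).1.1, (θ ⟨(x, y), hxy⟩).1.2))

/-- Reversal of pairs, as a map to the pairs of the dual order. -/
def LtPair.flip (p : LtPair Y) : LtPair Yᵒᵈ :=
  ⟨(OrderDual.toDual p.1.2, OrderDual.toDual p.1.1), p.2⟩

/-- Dualizing the target exchanges the two orders of composition, so decreasing cases reduce to
increasing ones. -/
lemma RespectsComp.flip {θ : LtPair X → LtPair Y} (hθ : RespectsComp θ) :
    RespectsComp (fun p => (θ p).flip) := by
  intro x y z hxy hyz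
  rcases hθ x y z hxy hyz with ⟨h1, h2⟩ | ⟨h1, h2⟩
  · right
    refine ⟨congrArg OrderDual.toDual h1.symm, ?_⟩
    simp [LtPair.flip, h2]
  · left
    refine ⟨congrArg OrderDual.toDual h1.symm, ?_⟩
    simp [LtPair.flip, h2]

/-- If `θ` preserves the order of composition on `x < y < z`, then it does so on `x < y < w` and
`x < z < w`. -/
lemma RespectsComp.increasing_of_increasing {θ : LtPair X → LtPair Y} (hθ : RespectsComp θ)
    {x y z w : X} (hxy : x < y) (hyz : y < z) (hzw : z < w)
    (h : (θ ⟨(x, y), hxy⟩).1.2 = (θ ⟨(y, z), hyz⟩).1.1) :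
    (θ ⟨(x, y), hxy⟩).1.2 = (θ ⟨(y, w), hyz.trans hzw⟩).1.1 ∧
      (θ ⟨(x, z), hxy.trans hyz⟩).1.2 = (θ ⟨(z, w), hzw⟩).1.1 := by
  have lt1 := (θ ⟨(x, y), hxy⟩).2
  have lt2 := (θ ⟨(y, z), hyz⟩).2
  have lt3 := (θ ⟨(z, w), hzw⟩).2
  have hxz : (θ ⟨(x, z), hxy.trans hyz⟩).1 =
      ((θ ⟨(x, y), hxy⟩).1.1, (θ ⟨(y, z), hyz⟩).1.2) := by
    rcases hθ x y z hxy hyz with ⟨-, h2⟩ | ⟨h1, -⟩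
    · exact h2
    · rw [h] at lt1
      exact absurd (h1 ▸ lt1.trans lt2) (lt_irrefl _)
  rcases hθ y z w hyz hzw with ⟨h1, h2⟩ | ⟨h1, h2⟩
  · rw [h2, hxz]
    exact ⟨h, h1⟩
  -- If `(y, z)` and `(z, w)` were composed in reverse, either order for `(x, z)` and `(z, w)` would
  -- produce a strict inequality contradicting `lt1` or `lt2`.
  · exfalso
    rcases hθ x z w (hxy.trans hyz) hzw with ⟨h3, -⟩ | ⟨h3, -⟩
    · rw [hxz] at h3
      rw [← h3, h1] at lt3
      exact lt_asymm lt2 lt3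
    · rw [hxz] at h3
      rw [h, ← h1, h3] at lt1
      exact lt_irrefl _ lt1

lemma RespectsComp.eq_of_increasing {θ : LtPair X → LtPair Y} (hθ : RespectsComp θ)
    {x y z : X} (hxy : x < y) (hyz : y < z)
    (h : (θ ⟨(x, y), hxy⟩).1.2 = (θ ⟨(y, z), hyz⟩).1.1) :
    (θ ⟨(x, z), hxy.trans hyz⟩).1 = ((θ ⟨(x, y), hxy⟩).1.1, (θ ⟨(y, z), hyz⟩).1.2) := by
  rcases hθ x y z hxy hyz with ⟨-, h2⟩ | ⟨h1, -⟩
  · exact h2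
  · have lt1 := (θ ⟨(x, y), hxy⟩).2
    have lt2 := (θ ⟨(y, z), hyz⟩).2
    rw [h] at lt1
    exact absurd (h1 ▸ lt1.trans lt2) (lt_irrefl _)

/-- The hypothesis at the vertex `u 1` propagates to all later vertices. The images of the pairs `(u
0, u i)` share their lower end, which is `v 0`; their upper ends are the other `v i`. -/
lemma RespectsComp.exists_map_of_increasing {θ : LtPair X → LtPair Y} (hθ : RespectsComp θ)
    {n : ℕ} (u : Fin (n + 2) → X) (hu : StrictMono u)
    (h : ∀ (j : Fin (n + 2)) (hj : 1 < j),
      (θ ⟨(u 0, u 1), hu Fin.zero_lt_one⟩).1.2 = (θ ⟨(u 1, u j), hu hj⟩).1.1) :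
    ∃ v : Fin (n + 2) → Y, StrictMono v ∧
      ∀ (i j : Fin (n + 2)) (hij : i < j), (θ ⟨(u i, u j), hu hij⟩ : Y × Y) = (v i, v j) := by
  have inc : ∀ (i j : Fin (n + 2)) (h0 : 0 < i) (hij : i < j),
      (θ ⟨(u 0, u i), hu h0⟩).1.2 = (θ ⟨(u i, u j), hu hij⟩).1.1 := by
    intro i j h0 hij
    have hle : (1 : Fin (n + 2)) ≤ i := Fin.one_le_of_ne_zero h0.ne'
    rcases hle.eq_or_lt with rfl | h1
    · exact h j hij
    · exact (hθ.increasing_of_increasing (hu Fin.zero_lt_one) (hu h1) (hu hij) (h i h1)).2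
  have first : ∀ (i : Fin (n + 2)) (h0 : 0 < i),
      (θ ⟨(u 0, u i), hu h0⟩).1.1 = (θ ⟨(u 0, u 1), hu Fin.zero_lt_one⟩).1.1 := by
    intro i h0
    have hle : (1 : Fin (n + 2)) ≤ i := Fin.one_le_of_ne_zero h0.ne'
    rcases hle.eq_or_lt with rfl | h1
    · rfl
    · rw [hθ.eq_of_increasing (hu Fin.zero_lt_one) (hu h1) (h i h1)]
  let v : Fin (n + 2) → Y := fun i =>
    if h0 : 0 < i then (θ ⟨(u 0, u i), hu h0⟩).1.2 else (θ ⟨(u 0, u 1), hu Fin.zero_lt_one⟩).1.1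
  have key : ∀ (i j : Fin (n + 2)) (hij : i < j),
      (θ ⟨(u i, u j), hu hij⟩ : Y × Y) = (v i, v j) := by
    intro i j hij
    have hj : 0 < j := (Fin.zero_le i).trans_lt hij
    have hvj : v j = (θ ⟨(u 0, u j), hu hj⟩).1.2 := dif_pos hj
    rcases (Fin.zero_le i).eq_or_lt with rfl | h0
    · have hv0 : v 0 = (θ ⟨(u 0, u 1), hu Fin.zero_lt_one⟩).1.1 := dif_neg (lt_irrefl _)
      rw [hv0, hvj, ← first j hij]
    · have hvi : v i = (θ ⟨(u 0, u i), hu h0⟩).1.2 := dif_pos h0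
      rw [hvi, hvj, inc i j h0 hij, hθ.eq_of_increasing (hu h0) (hu hij) (inc i j h0 hij)]
  refine ⟨v, fun i j hij => ?_, key⟩
  have := (θ ⟨(u i, u j), hu hij⟩).2
  rwa [key i j hij] at this

/-- A map respecting composition is monotone on every chain. -/
lemma RespectsComp.monotone_on_chain {θ : LtPair X → LtPair Y} (hθ : RespectsComp θ)
    {n : ℕ} (u : Fin (n + 2) → X) (hu : StrictMono u) :
    (∃ v : Fin (n + 2) → Y, StrictMono v ∧
      ∀ (i j : Fin (n + 2)) (hij : i < j), (θ ⟨(u i, u j), hu hij⟩ : Y × Y) = (v i, v j)) ∨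
    (∃ v : Fin (n + 2) → Y, StrictMono v ∧
      ∀ (i j : Fin (n + 2)) (hij : i < j),
        (θ ⟨(u i, u j), hu hij⟩ : Y × Y) = (v j.rev, v i.rev)) := by
  by_cases h : ∀ (j : Fin (n + 2)) (hj : 1 < j),
      (θ ⟨(u 0, u 1), hu Fin.zero_lt_one⟩).1.2 = (θ ⟨(u 1, u j), hu hj⟩).1.1
  · exact Or.inl (hθ.exists_map_of_increasing u hu h)
  right
  -- The order of composition at `u 1` cannot depend on the far end: the order found for the nearer
  -- of two far ends passes to the farther one.
  have h' : ∀ (j : Fin (n + 2)) (hj : 1 < j),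
      (θ ⟨(u 1, u j), hu hj⟩).1.2 = (θ ⟨(u 0, u 1), hu Fin.zero_lt_one⟩).1.1 := by
    by_contra hcon
    push Not at h hcon
    obtain ⟨i, hi, hi'⟩ := h
    obtain ⟨j, hj, hj'⟩ := hcon
    have hi2 := ((hθ _ _ _ (hu Fin.zero_lt_one) (hu hi)).resolve_left fun h => hi' h.1).1
    have hj2 := ((hθ _ _ _ (hu Fin.zero_lt_one) (hu hj)).resolve_right fun h => hj' h.1).1
    rcases lt_trichotomy i j with hij | rfl | hij
    · exact hj' (congrArg OrderDual.ofDual (hθ.flip.increasing_of_increasing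
        (hu Fin.zero_lt_one) (hu hi) (hu hij) (congrArg OrderDual.toDual hi2.symm)).1).symm
    · exact hi' hj2
    · exact hi' (hθ.increasing_of_increasing (hu Fin.zero_lt_one) (hu hj) (hu hij) hj2).1
  obtain ⟨v, hv, hvu⟩ := hθ.flip.exists_map_of_increasing u hu
    fun j hj => congrArg OrderDual.toDual (h' j hj).symm
  refine ⟨fun i => OrderDual.ofDual (v i.rev), fun i j hij => hv (Fin.rev_lt_rev.2 hij), ?_⟩
  intro i j hij
  have h1 := congrArg Prod.fst (hvu i j hij)
  have h2 := congrArg Prod.snd (hvu i j hij)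
  refine Prod.ext ?_ ?_
  · simpa [LtPair.flip] using congrArg OrderDual.ofDual h2
  · simpa [LtPair.flip] using congrArg OrderDual.ofDual h1

/-- A finite chain is the range of a strictly increasing sequence. -/
lemma exists_strictMono_range_eq [Finite X] {s : Set X} (hs : IsChain (· ≤ ·) s) :
    ∃ (n : ℕ) (u : Fin n → X), StrictMono u ∧ Set.range u = s := by
  classical
  let _ : LinearOrder s := hs.linearOrder
  have _ : Fintype s := Fintype.ofFinite s
  let e := Fintype.orderIsoFinOfCardEq s rfl
  refine ⟨_, fun i => (e i : s).1, fun i j hij => ?_, ?_⟩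
  · exact Subtype.coe_lt_coe.2 (e.lt_iff_lt.2 hij)
  · ext x
    constructor
    · rintro ⟨i, rfl⟩
      exact (e i).2
    · intro hx
      exact ⟨e.symm ⟨x, hx⟩, by simp⟩

lemma isChain_range_of_strictMono {n : ℕ} {u : Fin n → X} (hu : StrictMono u) :
    IsChain (· ≤ ·) (Set.range u) := by
  rintro _ ⟨i, rfl⟩ _ ⟨j, rfl⟩ -
  rcases le_total i j with h | h
  · exact Or.inl (hu.monotone h)
  · exact Or.inr (hu.monotone h)

lemma exists_isMaximalChain [Finite X] {s : Set X} (hs : IsChain (· ≤ ·) s) :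
    ∃ (n : ℕ) (u : Fin n → X), IsMaximalChain u ∧ s ⊆ Set.range u := by
  obtain ⟨M, hM, hsM⟩ := hs.exists_maxChain
  obtain ⟨n, u, hu, rfl⟩ := exists_strictMono_range_eq hM.1
  exact ⟨n, u, ⟨hu, hM⟩, hsM⟩

lemma IsMaximalChain.covBy {n : ℕ} {u : Fin (n + 1) → X} (hu : IsMaximalChain u) (i : Fin n) :
    u i.castSucc ⋖ u i.succ := by
  refine ⟨hu.1 Fin.castSucc_lt_succ, fun w h1 h2 => ?_⟩
  have hmem : w ∈ Set.range u := by
    by_contra hw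
    have hc : IsChain (· ≤ ·) (insert w (Set.range u)) := by
      refine hu.2.1.insert ?_
      rintro _ ⟨j, rfl⟩ -
      rcases le_or_gt j i.castSucc with h | h
      · exact Or.inr ((hu.1.monotone h).trans h1.le)
      · exact Or.inl (h2.le.trans (hu.1.monotone (Fin.castSucc_lt_iff_succ_le.1 h)))
    exact hw ((hu.2.2 hc (Set.subset_insert _ _)) ▸ Set.mem_insert _ _)
  obtain ⟨j, rfl⟩ := hmem
  have h3 := hu.1.lt_iff_lt.1 h1
  have h4 := hu.1.lt_iff_lt.1 h2
  exact absurd (Fin.castSucc_lt_iff_succ_le.1 h3) (not_le.2 h4)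

lemma ncard_range_of_strictMono {n : ℕ} {u : Fin n → X} (hu : StrictMono u) :
    (Set.range u).ncard = n := by
  rw [← Set.image_univ, Set.ncard_image_of_injective _ hu.injective, Set.ncard_univ]
  simp

/-- If the inverse of `θ` respects composition, then a chain whose pairs are the images of the
pairs of a maximal chain is maximal. -/
lemma isMaxChain_range_of_respectsComp [Finite X] {θ : Equiv.Perm (LtPair X)}
    (hθ' : RespectsComp θ.symm) {n : ℕ} {u v : Fin (n + 2) → X} (hu : IsMaximalChain u)
    (hv : StrictMono v)
    (h : ∀ i, ∃ p : LtPair X, (u i = p.1.1 ∨ u i = p.1.2) ∧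
      (θ p).1.1 ∈ Set.range v ∧ (θ p).1.2 ∈ Set.range v) :
    IsMaxChain (· ≤ ·) (Set.range v) := by
  refine ⟨isChain_range_of_strictMono hv, fun t ht hvt => ?_⟩
  have hcv := ncard_range_of_strictMono hv
  obtain ⟨k, w, hw, rfl⟩ := exists_strictMono_range_eq ht
  have hcw := ncard_range_of_strictMono hw
  have hle : n + 2 ≤ k := hcv ▸ hcw ▸ Set.ncard_le_ncard hvt
  obtain ⟨m, rfl⟩ := Nat.exists_eq_add_of_le' (le_trans (Nat.le_add_left 2 n) hle)
  -- `θ⁻¹` carries the pairs of the larger chain `w` into a chain `w'` of the same length. By `h`,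
  -- `w'` contains `u`, so maximality of `u` forces equal lengths, and `w` adds nothing to `v`.
  obtain ⟨w', hw', hmem⟩ : ∃ w' : Fin (m + 2) → X, StrictMono w' ∧
      ∀ (i j : Fin (m + 2)) (hij : i < j),
        (θ.symm ⟨(w i, w j), hw hij⟩).1.1 ∈ Set.range w' ∧
        (θ.symm ⟨(w i, w j), hw hij⟩).1.2 ∈ Set.range w' := by
    rcases hθ'.monotone_on_chain w hw with ⟨w', hw', h'⟩ | ⟨w', hw', h'⟩
    · refine ⟨w', hw', fun i j hij => ?_⟩
      rw [h' i j hij]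
      exact ⟨⟨i, rfl⟩, ⟨j, rfl⟩⟩
    · refine ⟨w', hw', fun i j hij => ?_⟩
      rw [h' i j hij]
      exact ⟨⟨j.rev, rfl⟩, ⟨i.rev, rfl⟩⟩
  have hsub : Set.range u ⊆ Set.range w' := by
    rintro _ ⟨i, rfl⟩
    obtain ⟨p, hp, h1, h2⟩ := h i
    obtain ⟨a, ha⟩ := hvt h1
    obtain ⟨b, hb⟩ := hvt h2
    have hab : a < b := by
      rw [← hw.lt_iff_lt, ha, hb]
      exact (θ p).2
    have hpe : θ.symm ⟨(w a, w b), hw hab⟩ = p := by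
      rw [Equiv.symm_apply_eq]
      exact Subtype.ext (Prod.ext ha hb)
    have := hmem a b hab
    rw [hpe] at this
    rcases hp with hp | hp
    · exact hp ▸ this.1
    · exact hp ▸ this.2
  have heq := hu.2.2 (isChain_range_of_strictMono hw') hsub
  have hcard : n + 2 = m + 2 := by
    rw [← ncard_range_of_strictMono hu.1, heq, ncard_range_of_strictMono hw']
  refine Set.eq_of_subset_of_ncard_le hvt ?_
  rw [hcv, hcw, hcard]

lemma isMonotoneOnMaxChains_of_respectsComp [Finite X] {θ : Equiv.Perm (LtPair X)}
    (hθ : RespectsComp θ) (hθ' : RespectsComp θ.symm) : IsMonotoneOnMaxChains θ := by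
  intro m u hu
  by_cases hm : m < 2
  · refine Or.inl ⟨u, hu, fun i j hij => ?_⟩
    have := i.2
    have := j.2
    have : i.1 < j.1 := hij
    omega
  obtain ⟨n, rfl⟩ := Nat.exists_eq_add_of_le' (not_lt.1 hm)
  have hpair : ∀ i : Fin (n + 2), ∃ (a b : Fin (n + 2)) (_ : a < b), u i = u a ∨ u i = u b := by
    intro i
    rcases (Fin.zero_le i).eq_or_lt with rfl | h0
    · exact ⟨0, 1, Fin.zero_lt_one, Or.inl rfl⟩
    · exact ⟨0, i, h0, Or.inr rfl⟩
  rcases hθ.monotone_on_chain u hu.1 with ⟨v, hv, h⟩ | ⟨v, hv, h⟩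
  · refine Or.inl ⟨v, ⟨hv, isMaxChain_range_of_respectsComp hθ' hu hv fun i => ?_⟩, h⟩
    obtain ⟨a, b, hab, hi⟩ := hpair i
    exact ⟨⟨(u a, u b), hu.1 hab⟩, hi, by rw [h a b hab]; exact ⟨⟨a, rfl⟩, ⟨b, rfl⟩⟩⟩
  · refine Or.inr ⟨v, ⟨hv, isMaxChain_range_of_respectsComp hθ' hu hv fun i => ?_⟩, h⟩
    obtain ⟨a, b, hab, hi⟩ := hpair i
    exact ⟨⟨(u a, u b), hu.1 hab⟩, hi, by rw [h a b hab]; exact ⟨⟨b.rev, rfl⟩, ⟨a.rev, rfl⟩⟩⟩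

/-- A map that is monotone on maximal chains respects composition. -/
lemma IsMonotoneOnMaxChains.respectsComp [Finite X] {θ : Equiv.Perm (LtPair X)}
    (hθ : IsMonotoneOnMaxChains θ) : RespectsComp θ := by
  intro x y z hxy hyz
  have hc : IsChain (· ≤ ·) ({x, y, z} : Set X) := by
    refine (IsChain.pair hyz.le).insert ?_
    rintro b (rfl | rfl) -
    · exact Or.inl hxy.le
    · exact Or.inl (hxy.trans hyz).le
  obtain ⟨n, u, hu, hsub⟩ := exists_isMaximalChain hc
  obtain ⟨i, rfl⟩ := hsub (show x ∈ ({x, y, z} : Set X) by simp)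
  obtain ⟨j, rfl⟩ := hsub (show y ∈ ({u i, y, z} : Set X) by simp)
  obtain ⟨k, rfl⟩ := hsub (show z ∈ ({u i, u j, z} : Set X) by simp)
  have hij := hu.1.lt_iff_lt.1 hxy
  have hjk := hu.1.lt_iff_lt.1 hyz
  rcases hθ n u hu with ⟨v, -, h⟩ | ⟨v, -, h⟩
  · left
    rw [h i j hij, h j k hjk, h i k (hij.trans hjk)]
    exact ⟨rfl, rfl⟩
  · right
    rw [h i j hij, h j k hjk, h i k (hij.trans hjk)]
    exact ⟨rfl, rfl⟩

/-- Every pair `x < y` lies on a maximal chain. -/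
lemma exists_isMaximalChain_pair [Finite X] (p : LtPair X) :
    ∃ (n : ℕ) (u : Fin (n + 2) → X) (i j : Fin (n + 2)) (hu : IsMaximalChain u) (hij : i < j),
      p = ⟨(u i, u j), hu.1 hij⟩ := by
  obtain ⟨⟨x, y⟩, hxy⟩ := p
  obtain ⟨n, u, hu, hsub⟩ := exists_isMaximalChain (IsChain.pair (r := (· ≤ ·)) hxy.le)
  obtain ⟨i, rfl⟩ := hsub (show x ∈ ({x, y} : Set X) by simp)
  obtain ⟨j, rfl⟩ := hsub (show y ∈ ({u i, y} : Set X) by simp)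
  have hij := hu.1.lt_iff_lt.1 hxy
  have hn : 2 ≤ n := by
    have := j.2
    have : i.1 < j.1 := hij
    omega
  obtain ⟨m, rfl⟩ := Nat.exists_eq_add_of_le' hn
  exact ⟨m, u, i, j, hu, hij, rfl⟩

end Chains

/-! ### Matrix entries, weights of the diagonal, and the center. -/

section Entries

variable {K X : Type*} [Field K] [PartialOrder X] [DecidableEq X]

lemma stdBasis_apply {x y : X} (h : x ≤ y) (u v : X) :
    stdBasis K x y h u v = if u = x ∧ v = y then 1 else 0 := rfl

lemma eD_apply (x u v : X) : eD K x u v = if u = x ∧ v = x then 1 else 0 := rfl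

lemma eB_apply (p : LtPair X) (u v : X) :
    eB K p u v = if u = p.1.1 ∧ v = p.1.2 then 1 else 0 := rfl

lemma eB_apply_self (p : LtPair X) : eB K p p.1.1 p.1.2 = 1 := by
  rw [eB_apply, if_pos ⟨rfl, rfl⟩]

lemma eB_apply_of_ne {p q : LtPair X} (h : p ≠ q) : eB K p q.1.1 q.1.2 = 0 := by
  rw [eB_apply, if_neg]
  rintro ⟨h1, h2⟩
  exact h (Subtype.ext (Prod.ext h1.symm h2.symm))

lemma eB_apply_diag (p : LtPair X) (u : X) : eB K p u u = 0 := by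
  rw [eB_apply, if_neg]
  rintro ⟨h1, h2⟩
  exact p.2.ne (h1.symm.trans h2)

lemma eB_ne_zero (p : LtPair X) : eB K p ≠ 0 := fun h => by
  have := eB_apply_self (K := K) p
  rw [h] at this
  exact zero_ne_one this

lemma eD_mem_diagonal (x : X) : eD K x ∈ diagonal K X := by
  intro u v huv
  rw [eD_apply, if_neg]
  rintro ⟨rfl, rfl⟩
  exact huv rfl

lemma finite_incidenceAlgebra [Finite X] : Module.Finite K (IncidenceAlgebra K X) := by
  let e : IncidenceAlgebra K X →ₗ[K] (X → X → K) :=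
    { toFun := fun f => f, map_add' := fun _ _ => rfl, map_smul' := fun _ _ => rfl }
  exact Module.Finite.of_injective e DFunLike.coe_injective

/-- The entry of an element of the incidence algebra at a given place, as a linear map. -/
def entry (u v : X) : IncidenceAlgebra K X →ₗ[K] K where
  toFun f := f u v
  map_add' _ _ := rfl
  map_smul' _ _ := rfl

lemma entry_apply (u v : X) (f : IncidenceAlgebra K X) : entry u v f = f u v := rfl

lemma sum_eD_apply [Fintype X] (g : X → K) (u v : X) :
    (∑ z, g z • eD K z) u v = if u = v then g u else 0 := by
  rw [← entry_apply u v, map_sum]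
  simp only [map_smul, entry_apply, eD_apply, smul_eq_mul]
  by_cases h : u = v
  · subst h
    rw [if_pos rfl, Finset.sum_eq_single u]
    · simp
    · intro z _ hz
      rw [if_neg (fun h => hz h.1.symm), mul_zero]
    · simp
  · rw [if_neg h]
    refine Finset.sum_eq_zero fun z _ => ?_
    rw [if_neg, mul_zero]
    rintro ⟨rfl, rfl⟩
    exact h rfl

lemma sum_eB_apply [Fintype (LtPair X)] (g : LtPair X → K) (q : LtPair X) :
    (∑ p, g p • eB K p) q.1.1 q.1.2 = g q := by
  rw [← entry_apply, map_sum, Finset.sum_eq_single q]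
  · simp [entry_apply, eB_apply_self]
  · intro p _ hp
    simp [entry_apply, eB_apply_of_ne hp]
  · simp

lemma sum_eB_apply_diag [Fintype (LtPair X)] (g : LtPair X → K) (u : X) :
    (∑ p, g p • eB K p) u u = 0 := by
  rw [← entry_apply, map_sum]
  exact Finset.sum_eq_zero fun p _ => by simp [entry_apply, eB_apply_diag]

lemma eq_sum_basis [Fintype X] [Fintype (LtPair X)] (f : IncidenceAlgebra K X) :
    f = ∑ p : LtPair X, f p.1.1 p.1.2 • eB K p + ∑ z, f z z • eD K z := by
  ext u v huv
  rw [IncidenceAlgebra.add_apply, sum_eD_apply]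
  rcases huv.eq_or_lt with rfl | h
  · rw [sum_eB_apply_diag, if_pos rfl, zero_add]
  · rw [if_neg h.ne, add_zero]
    exact (sum_eB_apply (fun p : LtPair X => f p.1.1 p.1.2) ⟨(u, v), h⟩).symm

lemma induction_basis [Finite X] {P : IncidenceAlgebra K X → Prop}
    (hB : ∀ p, P (eB K p)) (hD : ∀ z, P (eD K z)) (h0 : P 0)
    (hadd : ∀ f g, P f → P g → P (f + g)) (hsmul : ∀ (k : K) f, P f → P (k • f))
    (f : IncidenceAlgebra K X) : P f := by
  have _ := Fintype.ofFinite X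
  have _ := Fintype.ofFinite (LtPair X)
  rw [eq_sum_basis f]
  refine hadd _ _ (Finset.sum_induction _ P hadd h0 fun p _ => hsmul _ _ (hB p))
    (Finset.sum_induction _ P hadd h0 fun p _ => hsmul _ _ (hD p))

variable [LocallyFiniteOrder X]

lemma stdBasis_mul_apply {x y : X} (h : x ≤ y) (g : IncidenceAlgebra K X) (u v : X) :
    (stdBasis K x y h * g) u v = if u = x then g y v else 0 := by
  rw [IncidenceAlgebra.mul_apply]
  split_ifs with hu
  · subst hu
    by_cases hv : y ≤ v
    · rw [Finset.sum_eq_single_of_mem y (Finset.mem_Icc.2 ⟨h, hv⟩)]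
      · simp [stdBasis_apply]
      · intro w _ hw
        simp [stdBasis_apply, hw]
    · rw [IncidenceAlgebra.apply_eq_zero_of_not_le hv]
      refine Finset.sum_eq_zero fun w hw => ?_
      rw [stdBasis_apply, if_neg, zero_mul]
      rintro ⟨-, rfl⟩
      exact hv (Finset.mem_Icc.1 hw).2
  · exact Finset.sum_eq_zero fun w _ => by simp [stdBasis_apply, hu]

lemma diagonal_mul_apply {f : IncidenceAlgebra K X} (hf : f ∈ diagonal K X)
    (g : IncidenceAlgebra K X) (u v : X) : (f * g) u v = f u u * g u v := by
  rw [IncidenceAlgebra.mul_apply]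
  by_cases huv : u ≤ v
  · refine Finset.sum_eq_single_of_mem u (Finset.mem_Icc.2 ⟨le_rfl, huv⟩) fun w _ hw => ?_
    rw [hf u w hw.symm, zero_mul]
  · rw [Finset.Icc_eq_empty huv, Finset.sum_empty, IncidenceAlgebra.apply_eq_zero_of_not_le huv,
      mul_zero]

lemma mul_diagonal_apply {f : IncidenceAlgebra K X} (hf : f ∈ diagonal K X)
    (g : IncidenceAlgebra K X) (u v : X) : (g * f) u v = g u v * f v v := by
  rw [IncidenceAlgebra.mul_apply]
  by_cases huv : u ≤ v
  · refine Finset.sum_eq_single_of_mem v (Finset.mem_Icc.2 ⟨huv, le_rfl⟩) fun w _ hw => ?_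
    rw [hf w v hw, mul_zero]
  · rw [Finset.Icc_eq_empty huv, Finset.sum_empty, IncidenceAlgebra.apply_eq_zero_of_not_le huv,
      zero_mul]

/-- This is the weight decomposition for the action of `D` by brackets. -/
lemma diagonal_bracket_apply {f : IncidenceAlgebra K X} (hf : f ∈ diagonal K X)
    (g : IncidenceAlgebra K X) (u v : X) : ⁅f, g⁆ u v = (f u u - f v v) * g u v := by
  rw [Ring.lie_def, IncidenceAlgebra.sub_apply, diagonal_mul_apply hf, mul_diagonal_apply hf]
  ring

lemma diagonal_bracket_eB {f : IncidenceAlgebra K X} (hf : f ∈ diagonal K X) (p : LtPair X) :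
    ⁅f, eB K p⁆ = (f p.1.1 p.1.1 - f p.1.2 p.1.2) • eB K p := by
  ext u v _
  rw [diagonal_bracket_apply hf, IncidenceAlgebra.constSMul_apply, smul_eq_mul, eB_apply]
  split_ifs with h
  · rw [h.1, h.2]
  · simp

lemma diagonal_bracket_diagonal {f g : IncidenceAlgebra K X} (hf : f ∈ diagonal K X)
    (hg : g ∈ diagonal K X) : ⁅f, g⁆ = 0 := by
  ext u v _
  rw [diagonal_bracket_apply hf, IncidenceAlgebra.zero_apply]
  by_cases h : u = v
  · rw [h, sub_self, zero_mul]
  · rw [hg u v h, mul_zero]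

lemma eB_mul_eB_of_ne {p q : LtPair X} (h : p.1.2 ≠ q.1.1) : eB K p * eB K q = 0 := by
  ext u v _
  rw [eB, stdBasis_mul_apply, IncidenceAlgebra.zero_apply, eB_apply]
  split_ifs with h1 h2
  · exact absurd h2.1 h
  · rfl
  · rfl

lemma eB_mul_eB {p q r : LtPair X} (h : p.1.2 = q.1.1) (hr : r.1 = (p.1.1, q.1.2)) :
    eB K p * eB K q = eB K r := by
  ext u v _
  rw [eB, stdBasis_mul_apply, eB_apply, eB_apply, hr]
  split_ifs <;> simp_all

lemma ne_of_composable {p q : LtPair X} (h : p.1.2 = q.1.1) : q.1.2 ≠ p.1.1 := by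
  intro h'
  have h1 := p.2
  have h2 := q.2
  rw [h', ← h] at h2
  exact lt_asymm h1 h2

lemma bracket_eB_of_composable {p q r : LtPair X} (h : p.1.2 = q.1.1)
    (hr : r.1 = (p.1.1, q.1.2)) : ⁅eB K p, eB K q⁆ = eB K r := by
  rw [Ring.lie_def, eB_mul_eB h hr, eB_mul_eB_of_ne (ne_of_composable h), sub_zero]

lemma bracket_eB_of_not_composable {p q : LtPair X} (h : p.1.2 ≠ q.1.1) (h' : q.1.2 ≠ p.1.1) :
    ⁅eB K p, eB K q⁆ = 0 := by
  rw [Ring.lie_def, eB_mul_eB_of_ne h, eB_mul_eB_of_ne h', sub_zero]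

lemma mem_diagonal_of_mem_center {f : IncidenceAlgebra K X}
    (hf : f ∈ Subalgebra.center K (IncidenceAlgebra K X)) : f ∈ diagonal K X := by
  intro u v huv
  have h := congrArg (fun g : IncidenceAlgebra K X => g u v)
    (Subalgebra.mem_center_iff.1 hf (eD K u))
  simp only [diagonal_mul_apply (eD_mem_diagonal u), mul_diagonal_apply (eD_mem_diagonal u)] at h
  simpa [eD_apply, huv.symm] using h

lemma bracket_eq_zero_of_mem_center {f : IncidenceAlgebra K X}
    (hf : f ∈ Subalgebra.center K (IncidenceAlgebra K X)) (g : IncidenceAlgebra K X) :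
    ⁅f, g⁆ = 0 := by
  rw [Ring.lie_def, Subalgebra.mem_center_iff.1 hf g, sub_self]

lemma bracket_eq_zero_of_mem_center' {f : IncidenceAlgebra K X}
    (hf : f ∈ Subalgebra.center K (IncidenceAlgebra K X)) (g : IncidenceAlgebra K X) :
    ⁅g, f⁆ = 0 := by
  rw [Ring.lie_def, Subalgebra.mem_center_iff.1 hf g, sub_self]

lemma center_apply_eq_of_lt {f : IncidenceAlgebra K X}
    (hf : f ∈ Subalgebra.center K (IncidenceAlgebra K X)) {u v : X} (h : u < v) :
    f u u = f v v := by
  have h1 := bracket_eq_zero_of_mem_center hf (eB K ⟨(u, v), h⟩)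
  rw [diagonal_bracket_eB (mem_diagonal_of_mem_center hf)] at h1
  exact sub_eq_zero.1 ((smul_eq_zero.1 h1).resolve_right (eB_ne_zero _))

lemma center_apply_eq (hX : (SimpleGraph.hasse X).Connected) {f : IncidenceAlgebra K X}
    (hf : f ∈ Subalgebra.center K (IncidenceAlgebra K X)) (u v : X) : f u u = f v v := by
  obtain ⟨Γ⟩ := hX.preconnected u v
  induction Γ with
  | nil => rfl
  | cons h _ ih =>
    rw [← ih]
    rcases SimpleGraph.hasse_adj.1 h with h | h
    · exact center_apply_eq_of_lt hf h.lt
    · exact (center_apply_eq_of_lt hf h.lt).symm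

/-- A central element with a vanishing diagonal entry is zero. -/
lemma eq_zero_of_mem_center (hX : (SimpleGraph.hasse X).Connected) {f : IncidenceAlgebra K X}
    (hf : f ∈ Subalgebra.center K (IncidenceAlgebra K X)) {u : X} (hu : f u u = 0) : f = 0 := by
  ext v w _
  by_cases h : v = w
  · rw [← h, center_apply_eq hX hf v u, hu, IncidenceAlgebra.zero_apply]
  · rw [mem_diagonal_of_mem_center hf v w h, IncidenceAlgebra.zero_apply]

/-- The pair `p` is determined by the functional `f ↦ f p.1 p.1 - f p.2 p.2` on the diagonal. -/
lemma ltPair_eq_of_weight_eq {p q : LtPair X}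
    (h : ∀ z, eD K z p.1.1 p.1.1 - eD K z p.1.2 p.1.2 =
      eD K z q.1.1 q.1.1 - eD K z q.1.2 q.1.2) : p = q := by
  obtain ⟨⟨u, v⟩, huv⟩ := p
  obtain ⟨⟨u', v'⟩, huv'⟩ := q
  simp only [eD_apply, and_self] at h
  simp only at huv huv'
  have h1 := h u
  have h2 := h v
  simp only [huv.ne, huv.ne', if_true, if_false, sub_zero, zero_sub] at h1 h2
  -- The only alternative is `(u', v') = (v, u)`, which has the same weight in characteristic two;
  -- the order rules it out.
  have hu : u = u' := by
    by_contra hne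
    have hv' : v' = u := by
      by_contra hv'
      simp [hv', Ne.symm hne] at h1
    have : v = u' := by
      by_contra hv
      have : v' ≠ v := fun h => huv.ne (hv'.symm.trans h)
      simp [Ne.symm hv, this] at h2
    subst hv' this
    exact lt_asymm huv huv'
  subst hu
  have hv : v = v' := by
    by_contra hne
    simp [huv.ne, Ne.symm hne] at h2
  subst hv
  rfl

end Entries

/-! ### Sums along walks and the diagonal coefficients of `τ`. -/

section WalkSums

variable {K X : Type*} [Field K] [PartialOrder X] [DecidableEq X]
  (θ : Equiv.Perm (LtPair X)) (c : LtPair X → Kˣ)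

/-- The increment of the diagonal coefficients of `τ(e_z)` along the step from `u` to `v`. -/
noncomputable def increment (z u v : X) : K :=
  -lowerTerm θ c z u v + lowerTerm θ c z v u + upperTerm θ c z u v - upperTerm θ c z v u

/-- The sum of the increments along a walk. -/
noncomputable def walkSum {a b : X} (Γ : (SimpleGraph.hasse X).Walk a b) (z : X) : K :=
  ∑ i ∈ Finset.range Γ.length, increment θ c z (Γ.getVert i) (Γ.getVert (i + 1))

lemma walkSum_eq {a b : X} (Γ : (SimpleGraph.hasse X).Walk a b) (z : X) :
    walkSum θ c Γ z = -sPlus θ c Γ z + sMinus θ c Γ z + tPlus θ c Γ z - tMinus θ c Γ z := by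
  simp only [walkSum, increment, sPlus, sMinus, tPlus, tMinus, Finset.sum_sub_distrib,
    Finset.sum_add_distrib, Finset.sum_neg_distrib]

lemma isAdmissible_iff_walkSum : IsAdmissible θ c ↔
    ∀ (a : X) (Γ : (SimpleGraph.hasse X).Walk a a) (z : X), walkSum θ c Γ z = 0 := by
  refine forall_congr' fun a => forall_congr' fun Γ => forall_congr' fun z => ?_
  rw [walkSum_eq]
  constructor
  · intro h
    linear_combination -h
  · intro h
    linear_combination -h

lemma increment_swap (z u v : X) : increment θ c z v u = -increment θ c z u v := by
  simp only [increment]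
  ring

/-- The link between walks and brackets: across `θ p` the increment is `-c p` times the weight of
`e_z` at `p`. -/
lemma increment_apply (p : LtPair X) (z : X) :
    increment θ c z (θ p).1.1 (θ p).1.2 =
      c p * (eD K z p.1.2 p.1.2 - eD K z p.1.1 p.1.1) := by
  have h := (θ p).2
  have hs : θ.symm ⟨((θ p).1.1, (θ p).1.2), h⟩ = p := θ.symm_apply_apply p
  rw [increment, lowerTerm, lowerTerm, upperTerm, upperTerm, dif_pos h, dif_neg h.not_gt,
    dif_pos h, dif_neg h.not_gt, hs]
  simp only [eD_apply, and_self]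
  split_ifs <;> ring

@[simp] lemma walkSum_nil (a z : X) :
    walkSum θ c (SimpleGraph.Walk.nil : (SimpleGraph.hasse X).Walk a a) z = 0 := by
  simp [walkSum]

@[simp] lemma walkSum_cons {a b d : X} (h : (SimpleGraph.hasse X).Adj a b)
    (Γ : (SimpleGraph.hasse X).Walk b d) (z : X) :
    walkSum θ c (SimpleGraph.Walk.cons h Γ) z = increment θ c z a b + walkSum θ c Γ z := by
  simp only [walkSum, SimpleGraph.Walk.length_cons, Finset.sum_range_succ',
    SimpleGraph.Walk.getVert_cons_succ, SimpleGraph.Walk.getVert_zero]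
  rw [add_comm]

lemma walkSum_append {a b d : X} (Γ : (SimpleGraph.hasse X).Walk a b)
    (Γ' : (SimpleGraph.hasse X).Walk b d) (z : X) :
    walkSum θ c (Γ.append Γ') z = walkSum θ c Γ z + walkSum θ c Γ' z := by
  induction Γ with
  | nil => simp
  | cons h _ ih => rw [SimpleGraph.Walk.cons_append, walkSum_cons, walkSum_cons, ih, add_assoc]

lemma walkSum_reverse {a b : X} (Γ : (SimpleGraph.hasse X).Walk a b) (z : X) :
    walkSum θ c Γ.reverse z = -walkSum θ c Γ z := by
  induction Γ with
  | nil => simp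
  | cons h _ ih =>
    rw [SimpleGraph.Walk.reverse_cons, walkSum_append, walkSum_cons, walkSum_cons, walkSum_nil, ih,
      increment_swap]
    ring

lemma walkSum_eq_sub {z : X} {g : X → K}
    (hg : ∀ u v, u ⋖ v → increment θ c z u v = g v - g u) {a b : X}
    (Γ : (SimpleGraph.hasse X).Walk a b) : walkSum θ c Γ z = g b - g a := by
  induction Γ with
  | nil => simp
  | cons h _ ih =>
    rw [walkSum_cons, ih]
    rcases SimpleGraph.hasse_adj.1 h with h | h
    · rw [hg _ _ h]
      ring
    · rw [increment_swap, hg _ _ h]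
      ring

variable {θ c} (hX : (SimpleGraph.hasse X).Connected) (x₀ : X) (κ : X → K)

lemma tauDiag_eq (z v : X) : tauDiag hX x₀ θ c κ z v =
    κ z + walkSum θ c (hX.preconnected x₀ v).some z := by
  rw [walkSum_eq]
  rfl

/-- The chosen walk to `u`, the step to `v` and the reversed chosen walk to `v` form a closed walk,
whose sum vanishes. -/
lemma IsAdmissible.tauDiag_sub (h : IsAdmissible θ c) {u v : X} (huv : u ⋖ v) (z : X) :
    tauDiag hX x₀ θ c κ z v - tauDiag hX x₀ θ c κ z u = increment θ c z u v := by
  rw [tauDiag_eq, tauDiag_eq]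
  have h1 := (isAdmissible_iff_walkSum θ c).1 h x₀ ((hX.preconnected x₀ u).some.append
    (SimpleGraph.Walk.cons (SimpleGraph.hasse_adj.2 (Or.inl huv))
      (hX.preconnected x₀ v).some.reverse)) z
  rw [walkSum_append, walkSum_cons, walkSum_reverse] at h1
  linear_combination -h1

lemma tauDiag_eq_of_increment {z : X} {g : X → K}
    (hg : ∀ u v, u ⋖ v → increment θ c z u v = g v - g u) (hκ : κ z = g x₀) (v : X) :
    tauDiag hX x₀ θ c κ z v = g v := by
  rw [tauDiag_eq, walkSum_eq_sub θ c hg, hκ]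
  ring

lemma isAdmissible_of_increment {g : X → X → K}
    (hg : ∀ z u v, u ⋖ v → increment θ c z u v = g z v - g z u) : IsAdmissible θ c :=
  (isAdmissible_iff_walkSum θ c).2 fun a Γ z => by rw [walkSum_eq_sub θ c (hg z), sub_self]

variable [Fintype X] (σ : LtPair X → Kˣ)

lemma tau_eB (p : LtPair X) :
    tau hX x₀ θ σ c κ (eB K p) = (σ p : K) • eB K (θ p) := by
  simp only [tau, LinearMap.coe_mk, AddHom.coe_mk, eB_apply_diag, zero_smul,
    Finset.sum_const_zero, add_zero]
  rw [Finset.sum_eq_single p]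
  · rw [eB_apply_self, one_smul]
  · intro q _ hq
    rw [eB_apply_of_ne hq.symm, zero_smul]
  · simp

lemma tau_eD (z : X) :
    tau hX x₀ θ σ c κ (eD K z) = ∑ v : X, tauDiag hX x₀ θ c κ z v • eD K v := by
  simp only [tau, LinearMap.coe_mk, AddHom.coe_mk]
  rw [Finset.sum_eq_zero, zero_add, Finset.sum_eq_single z]
  · simp [eD_apply]
  · intro q _ hq
    simp [eD_apply, hq]
  · simp
  · intro p _
    rw [eD_mem_diagonal z _ _ p.2.ne, zero_smul]

lemma tau_eD_apply (z u v : X) : tau hX x₀ θ σ c κ (eD K z) u v =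
    if u = v then tauDiag hX x₀ θ c κ z u else 0 := by
  rw [tau_eD, sum_eD_apply]

lemma tau_eD_mem_diagonal (z : X) : tau hX x₀ θ σ c κ (eD K z) ∈ diagonal K X := by
  intro u v huv
  rw [tau_eD_apply, if_neg huv]

/-- Increments are prescribed only across covering pairs, and `θ p` need not be one. But `p` lies on
a maximal chain whose image is a maximal chain, and the identity telescopes along its covering
steps. -/
lemma tauDiag_sub_of_constant (hθ : IsMonotoneOnMaxChains θ) (h : IsAdmissible θ c) {k : Kˣ}
    (hc : ∀ p, c p = k) (p : LtPair X) (z : X) :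
    tauDiag hX x₀ θ c κ z (θ p).1.2 - tauDiag hX x₀ θ c κ z (θ p).1.1 =
      k * (eD K z p.1.2 p.1.2 - eD K z p.1.1 p.1.1) := by
  have hstep : ∀ q : LtPair X, (θ q).1.1 ⋖ (θ q).1.2 →
      tauDiag hX x₀ θ c κ z (θ q).1.2 - tauDiag hX x₀ θ c κ z (θ q).1.1 =
        k * (eD K z q.1.2 q.1.2 - eD K z q.1.1 q.1.1) := by
    intro q hq
    rw [h.tauDiag_sub hX x₀ κ hq, increment_apply, hc]
  obtain ⟨n, u, i, j, hu, hij, rfl⟩ := exists_isMaximalChain_pair p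
  rcases hθ _ u hu with ⟨v, hv, hvu⟩ | ⟨v, hv, hvu⟩
  · have hconst : ∀ a : Fin (n + 2), tauDiag hX x₀ θ c κ z (v a) - k * eD K z (u a) (u a) =
        tauDiag hX x₀ θ c κ z (v 0) - k * eD K z (u 0) (u 0) := by
      intro a
      induction a using Fin.induction with
      | zero => rfl
      | succ a ih =>
        have := hstep ⟨(u a.castSucc, u a.succ), hu.1 Fin.castSucc_lt_succ⟩
        rw [hvu a.castSucc a.succ Fin.castSucc_lt_succ] at this
        rw [← ih]
        linear_combination this (hv.covBy a)
    rw [hvu i j hij]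
    linear_combination hconst j - hconst i
  · have hconst : ∀ a : Fin (n + 2), tauDiag hX x₀ θ c κ z (v a.rev) + k * eD K z (u a) (u a) =
        tauDiag hX x₀ θ c κ z (v (Fin.rev 0)) + k * eD K z (u 0) (u 0) := by
      intro a
      induction a using Fin.induction with
      | zero => rfl
      | succ a ih =>
        have := hstep ⟨(u a.castSucc, u a.succ), hu.1 Fin.castSucc_lt_succ⟩
        rw [hvu a.castSucc a.succ Fin.castSucc_lt_succ] at this
        rw [← ih]
        have hcov := hv.covBy a.rev
        rw [← Fin.rev_castSucc, ← Fin.rev_succ] at hcov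
        linear_combination -this hcov
    rw [hvu i j hij]
    linear_combination hconst i - hconst j

end WalkSums

/-! ### Lie automorphisms preserving the diagonal. -/

section LieAutomorphisms

attribute [local instance 100] LieRing.ofAssociativeRing

variable {K X : Type*} [Field K] [PartialOrder X] [Finite X] [DecidableEq X]
  [LocallyFiniteOrder X]

/-- A bijective linear map that preserves diagonality maps the diagonal onto itself. -/
lemma exists_diagonal_preimage {ψ : IncidenceAlgebra K X →ₗ[K] IncidenceAlgebra K X}
    (hψ : Function.Injective ψ) (hd : IsDiagonalityPreserver ψ) {g : IncidenceAlgebra K X}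
    (hg : g ∈ diagonal K X) : ∃ f ∈ diagonal K X, ψ f = g := by
  have _ : Module.Finite K (IncidenceAlgebra K X) := finite_incidenceAlgebra
  have hinj : Function.Injective (ψ.restrict hd) := fun a b hab =>
    Subtype.ext (hψ (congrArg Subtype.val hab))
  obtain ⟨f, hf⟩ := LinearMap.surjective_of_injective hinj ⟨g, hg⟩
  exact ⟨f.1, f.2, congrArg Subtype.val hf⟩

/-- Apply `ψ` to `[f, e_p] = weight • e_p` and cancel the non-zero entry at `(u, v)`. -/
lemma weight_of_ne_zero {ψ : IncidenceAlgebra K X ≃ₗ⁅K⁆ IncidenceAlgebra K X}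
    (hd : ∀ f ∈ diagonal K X, ψ f ∈ diagonal K X) (p : LtPair X) {u v : X}
    (h : ψ (eB K p) u v ≠ 0) {f : IncidenceAlgebra K X} (hf : f ∈ diagonal K X) :
    ψ f u u - ψ f v v = f p.1.1 p.1.1 - f p.1.2 p.1.2 := by
  have h1 := congrArg (fun g => ψ g u v) (diagonal_bracket_eB hf p)
  simp only [LieEquiv.map_lie, map_smul] at h1
  rw [diagonal_bracket_apply (hd f hf), IncidenceAlgebra.constSMul_apply, smul_eq_mul] at h1
  exact mul_right_cancel₀ h h1

/-- A Lie automorphism that preserves diagonality permutes the basis of the radical up to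
scalars. -/
lemma exists_perm_of_lieEquiv (ψ : IncidenceAlgebra K X ≃ₗ⁅K⁆ IncidenceAlgebra K X)
    (hd : ∀ f ∈ diagonal K X, ψ f ∈ diagonal K X) :
    ∃ (θ : Equiv.Perm (LtPair X)) (σ : LtPair X → Kˣ),
      (∀ p, ψ (eB K p) = (σ p : K) • eB K (θ p)) ∧
      ∀ p, ∀ f ∈ diagonal K X, ψ f (θ p).1.1 (θ p).1.1 - ψ f (θ p).1.2 (θ p).1.2 =
        f p.1.1 p.1.1 - f p.1.2 p.1.2 := by
  -- Weights are known only on images `ψ f`; surjectivity on `D` lets them be compared on every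
  -- `e_z`.
  have hsurj : ∀ z : X, ∃ f ∈ diagonal K X, ψ f = eD K z := fun z =>
    exists_diagonal_preimage (ψ := (ψ : IncidenceAlgebra K X →ₗ[K] IncidenceAlgebra K X))
      ψ.injective hd (eD_mem_diagonal z)
  have hdiag : ∀ (p : LtPair X) (u : X), ψ (eB K p) u u = 0 := by
    intro p u
    by_contra h
    have h1 := weight_of_ne_zero hd p h (eD_mem_diagonal p.1.1)
    simp [eD_apply, p.2.ne'] at h1
  have hex : ∀ p : LtPair X, ∃ q : LtPair X, ψ (eB K p) q.1.1 q.1.2 ≠ 0 := by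
    intro p
    by_contra! hcon
    refine eB_ne_zero (K := K) p (ψ.injective ?_)
    rw [map_zero]
    ext u v huv
    rcases huv.eq_or_lt with rfl | h
    · exact hdiag p u
    · exact hcon ⟨(u, v), h⟩
  choose θ hθ using hex
  have hw := fun p f hf => weight_of_ne_zero hd p (f := f) (hθ p) hf
  have hinj : Function.Injective θ := by
    intro p q hpq
    refine ltPair_eq_of_weight_eq (K := K) fun z => ?_
    rw [← hw p _ (eD_mem_diagonal z), ← hw q _ (eD_mem_diagonal z), hpq]
  refine ⟨Equiv.ofBijective θ (Finite.injective_iff_bijective.1 hinj),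
    fun p => Units.mk0 _ (hθ p), fun p => ?_, hw⟩
  ext u v huv
  rw [IncidenceAlgebra.constSMul_apply, smul_eq_mul, Units.val_mk0, Equiv.ofBijective_apply]
  rcases huv.eq_or_lt with rfl | h
  · rw [hdiag, eB_apply_diag, mul_zero]
  · by_cases hq : θ p = ⟨(u, v), h⟩
    · have h1 := eB_apply_self (K := K) (θ p)
      rw [hq] at h1 ⊢
      rw [h1, mul_one]
    · have h1 := eB_apply_of_ne (K := K) hq
      rw [h1, mul_zero]
      by_contra hne
      refine hq (ltPair_eq_of_weight_eq (K := K) fun z => ?_)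
      obtain ⟨f, hf, hfz⟩ := hsurj z
      rw [← hfz]
      rw [hw p f hf, weight_of_ne_zero hd p hne hf]

lemma composable_of_bracket_ne_zero {p q : LtPair X} (h : ⁅eB K p, eB K q⁆ ≠ 0) :
    p.1.2 = q.1.1 ∨ q.1.2 = p.1.1 := by
  by_contra! hcon
  exact h (bracket_eB_of_not_composable hcon.1 hcon.2)

lemma eq_of_smul_eB_eq {p q : LtPair X} {a b : K} (ha : a ≠ 0) (h : a • eB K p = b • eB K q) :
    p = q := by
  by_contra hne
  have h1 := congrArg (fun g : IncidenceAlgebra K X => g p.1.1 p.1.2) h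
  simp only [IncidenceAlgebra.constSMul_apply, eB_apply_self, eB_apply_of_ne (Ne.symm hne),
    smul_eq_mul, mul_one, mul_zero] at h1
  exact ha h1

/-- The image of `[e_{xy}, e_{yz}] = e_{xz}` is non-zero, so the two image pairs compose in some
order. -/
lemma respectsComp_of_map_lie {ψ : IncidenceAlgebra K X ≃ₗ⁅K⁆ IncidenceAlgebra K X}
    {θ : LtPair X → LtPair X} {σ : LtPair X → Kˣ}
    (h : ∀ p, ψ (eB K p) = (σ p : K) • eB K (θ p)) : RespectsComp θ := by
  intro x y z hxy hyz
  have h1 := congrArg ψ (bracket_eB_of_composable (K := K) (p := ⟨(x, y), hxy⟩)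
    (q := ⟨(y, z), hyz⟩) (r := ⟨(x, z), hxy.trans hyz⟩) rfl rfl)
  rw [LieEquiv.map_lie, h, h, h, smul_lie, lie_smul, smul_smul] at h1
  have hne : ⁅eB K (θ ⟨(x, y), hxy⟩), eB K (θ ⟨(y, z), hyz⟩)⁆ ≠ 0 := by
    intro h0
    rw [h0, smul_zero] at h1
    exact (smul_ne_zero (Units.ne_zero _) (eB_ne_zero _)) h1.symm
  rcases composable_of_bracket_ne_zero hne with hc | hc
  · refine Or.inl ⟨hc, ?_⟩
    have hlt := (θ ⟨(x, y), hxy⟩).2.trans (hc ▸ (θ ⟨(y, z), hyz⟩).2)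
    rw [bracket_eB_of_composable (r := ⟨(_, _), hlt⟩) hc rfl] at h1
    rw [eq_of_smul_eB_eq (Units.ne_zero _) h1.symm]
  · refine Or.inr ⟨hc, ?_⟩
    have hlt := (θ ⟨(y, z), hyz⟩).2.trans (hc ▸ (θ ⟨(x, y), hxy⟩).2)
    rw [← lie_skew, bracket_eB_of_composable (r := ⟨(_, _), hlt⟩) hc rfl, smul_neg,
      ← neg_smul] at h1
    rw [eq_of_smul_eB_eq (Units.ne_zero _) h1.symm]

lemma scalar_of_map_lie {ψ : IncidenceAlgebra K X ≃ₗ⁅K⁆ IncidenceAlgebra K X}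
    {θ : LtPair X → LtPair X} {σ : LtPair X → Kˣ}
    (h : ∀ p, ψ (eB K p) = (σ p : K) • eB K (θ p)) {x y z : X} (hxy : x < y) (hyz : y < z) :
    (eB K (θ ⟨(x, z), hxy.trans hyz⟩) = eB K (θ ⟨(x, y), hxy⟩) * eB K (θ ⟨(y, z), hyz⟩) →
      (σ ⟨(x, z), hxy.trans hyz⟩ : K) = σ ⟨(x, y), hxy⟩ * σ ⟨(y, z), hyz⟩) ∧
    (eB K (θ ⟨(x, z), hxy.trans hyz⟩) = eB K (θ ⟨(y, z), hyz⟩) * eB K (θ ⟨(x, y), hxy⟩) →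
      (σ ⟨(x, z), hxy.trans hyz⟩ : K) = -(σ ⟨(x, y), hxy⟩ * σ ⟨(y, z), hyz⟩)) := by
  have h1 := congrArg ψ (bracket_eB_of_composable (K := K) (p := ⟨(x, y), hxy⟩)
    (q := ⟨(y, z), hyz⟩) (r := ⟨(x, z), hxy.trans hyz⟩) rfl rfl)
  rw [LieEquiv.map_lie, h, h, h, smul_lie, lie_smul, smul_smul, Ring.lie_def] at h1
  have hprod : ∀ {p q r : LtPair X}, eB K r = eB K p * eB K q → p.1.2 = q.1.1 := by
    intro p q r hr
    by_contra hne
    rw [eB_mul_eB_of_ne hne] at hr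
    exact eB_ne_zero r hr
  constructor
  · intro he
    rw [eB_mul_eB_of_ne (ne_of_composable (hprod he)), sub_zero, ← he] at h1
    exact (smul_left_injective K (eB_ne_zero _) h1).symm
  · intro he
    rw [eB_mul_eB_of_ne (ne_of_composable (hprod he)), zero_sub, ← he, smul_neg, ← neg_smul] at h1
    exact (smul_left_injective K (eB_ne_zero _) h1).symm

/-- The shape of a Lie type preserver that preserves diagonality. -/
lemma IsOfLieType.exists_data {φ : IncidenceAlgebra K X →ₗ[K] IncidenceAlgebra K X}
    (hφ : IsOfLieType φ) (hd : IsDiagonalityPreserver φ) :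
    ∃ (k : Kˣ) (θ : Equiv.Perm (LtPair X)) (σ : LtPair X → Kˣ)
      (ξ : IncidenceAlgebra K X →ₗ[K] IncidenceAlgebra K X),
      (∀ f, ξ f ∈ Subalgebra.center K (IncidenceAlgebra K X)) ∧
      (∀ p, φ (eB K p) = (σ p : K) • eB K (θ p) + ξ (eB K p)) ∧
      (∀ p, ∀ f ∈ diagonal K X, φ f (θ p).1.1 (θ p).1.1 - φ f (θ p).1.2 (θ p).1.2 =
        k * (f p.1.1 p.1.1 - f p.1.2 p.1.2)) ∧
      IsMonotoneOnMaxChains θ ∧ IsCompatible θ σ (fun _ => k) ∧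
      φ 1 ∈ Subalgebra.center K (IncidenceAlgebra K X) := by
  obtain ⟨-, k, ψ, ξ, hk, hξ, hφ⟩ := hφ
  have hψ : ∀ f, ψ f = k⁻¹ • (φ f - ξ f) := fun f => by
    rw [hφ, add_sub_cancel_right, smul_smul, inv_mul_cancel₀ hk, one_smul]
  have hdψ : ∀ f ∈ diagonal K X, ψ f ∈ diagonal K X := fun f hf => by
    rw [hψ]
    exact Submodule.smul_mem _ _ (sub_mem (hd f hf) (mem_diagonal_of_mem_center (hξ f)))
  obtain ⟨θ, σ, h1, h2⟩ := exists_perm_of_lieEquiv ψ hdψ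
  have h1' : ∀ p, ψ.symm (eB K p) = (((σ (θ.symm p))⁻¹ : Kˣ) : K) • eB K (θ.symm p) := by
    intro p
    apply ψ.injective
    change ψ (ψ.symm (eB K p)) = ψ (_ • _)
    rw [map_smul, h1, LieEquiv.apply_symm_apply, Equiv.apply_symm_apply, smul_smul,
      Units.inv_mul, one_smul]
  -- The scalars of `φ` are `k σ`, so the multiplicative rule for `σ`, times `k²`, becomes
  -- compatibility with `c = k`.
  refine ⟨Units.mk0 k hk, θ, fun p => Units.mk0 k hk * σ p, ξ, hξ, ?_, ?_, ?_, ?_, ?_⟩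
  · intro p
    rw [hφ, h1, smul_smul]
    rfl
  · intro p f hf
    simp only [hφ, IncidenceAlgebra.add_apply, IncidenceAlgebra.constSMul_apply, smul_eq_mul,
      Units.val_mk0]
    linear_combination k * h2 p f hf + center_apply_eq_of_lt (hξ f) (θ p).2
  · exact isMonotoneOnMaxChains_of_respectsComp (respectsComp_of_map_lie h1)
      (respectsComp_of_map_lie h1')
  · intro x y z hxy hyz
    obtain ⟨ha, hb⟩ := scalar_of_map_lie h1 hxy hyz
    simp only [Units.val_mul, Units.val_mk0]
    refine ⟨fun he => ?_, fun he => ?_⟩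
    · linear_combination k * k * ha he
    · linear_combination k * k * hb he
  · rw [hφ]
    refine add_mem (Subalgebra.smul_mem _ ?_ _) (hξ 1)
    rw [Subalgebra.mem_center_iff]
    intro b
    obtain ⟨a, rfl⟩ := ψ.surjective b
    have : ⁅a, (1 : IncidenceAlgebra K X)⁆ = 0 := by rw [Ring.lie_def, mul_one, one_mul, sub_self]
    have h3 := congrArg ψ this
    rwa [LieEquiv.map_lie, map_zero, Ring.lie_def, sub_eq_zero] at h3

end LieAutomorphisms

/-! ### Lie type in terms of the decomposition. -/

section LieType

attribute [local instance 100] LieRing.ofAssociativeRing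

variable {K X : Type*} [Field K] [PartialOrder X] [Fintype X] [DecidableEq X]
  [LocallyFiniteOrder X] (hX : (SimpleGraph.hasse X).Connected) (x₀ : X)

lemma shift_apply (α : IncidenceAlgebra K X →ₗ[K] diagonal K X) (f : IncidenceAlgebra K X) :
    shift α f = f + (α f : IncidenceAlgebra K X) := rfl

variable {θ : Equiv.Perm (LtPair X)} {σ c : LtPair X → Kˣ} {κ : X → K}

lemma tau_bracket_eB_of_composable (hτ : IsTauData θ σ c κ) {k : Kˣ} (hc : ∀ p, c p = k)
    {p q : LtPair X} (h : p.1.2 = q.1.1) :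
    ⁅tau hX x₀ θ σ c κ (eB K p), tau hX x₀ θ σ c κ (eB K q)⁆ =
      (k : K) • tau hX x₀ θ σ c κ ⁅eB K p, eB K q⁆ := by
  obtain ⟨⟨x, y⟩, hxy⟩ := p
  obtain ⟨⟨y', z⟩, hyz⟩ := q
  obtain rfl : y = y' := h
  have hxz : x < z := lt_trans hxy hyz
  rw [bracket_eB_of_composable (r := ⟨(x, z), hxz⟩) rfl rfl, tau_eB, tau_eB, tau_eB,
    smul_lie, lie_smul, smul_smul, smul_smul]
  have hcompat := hτ.compatible x y z hxy hyz
  rw [hc] at hcompat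
  rcases hτ.monotone.respectsComp x y z hxy hyz with ⟨h1, h2⟩ | ⟨h1, h2⟩
  · rw [bracket_eB_of_composable h1 h2, hcompat.1 (eB_mul_eB h1 h2).symm]
  · rw [← lie_skew, bracket_eB_of_composable h1 h2, hcompat.2 (eB_mul_eB h1 h2).symm, smul_neg,
      neg_smul]

lemma tau_bracket_eD_eB (hτ : IsTauData θ σ c κ) {k : Kˣ} (hc : ∀ p, c p = k)
    (z : X) (p : LtPair X) :
    ⁅tau hX x₀ θ σ c κ (eD K z), tau hX x₀ θ σ c κ (eB K p)⁆ =
      (k : K) • tau hX x₀ θ σ c κ ⁅eD K z, eB K p⁆ := by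
  rw [diagonal_bracket_eB (eD_mem_diagonal z), map_smul, tau_eB, lie_smul,
    diagonal_bracket_eB (tau_eD_mem_diagonal hX x₀ κ σ z), smul_smul, smul_smul, smul_smul]
  congr 1
  have := tauDiag_sub_of_constant hX x₀ κ hτ.monotone hτ.admissible hc p z
  rw [tau_eD_apply, tau_eD_apply, if_pos rfl, if_pos rfl]
  linear_combination -(σ p : K) * this

/-- If `c` is constant and `τ` preserves commutativity, then `τ` is a scalar multiple of a Lie
homomorphism. -/
lemma tau_bracket (hτ : IsTauData θ σ c κ) {k : Kˣ} (hc : ∀ p, c p = k)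
    (hs : IsStrongCommPreserver (tau hX x₀ θ σ c κ)) (f g : IncidenceAlgebra K X) :
    ⁅tau hX x₀ θ σ c κ f, tau hX x₀ θ σ c κ g⁆ = (k : K) • tau hX x₀ θ σ c κ ⁅f, g⁆ := by
  have skew : ∀ f g : IncidenceAlgebra K X,
      ⁅tau hX x₀ θ σ c κ f, tau hX x₀ θ σ c κ g⁆ = (k : K) • tau hX x₀ θ σ c κ ⁅f, g⁆ →
      ⁅tau hX x₀ θ σ c κ g, tau hX x₀ θ σ c κ f⁆ = (k : K) • tau hX x₀ θ σ c κ ⁅g, f⁆ := by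
    intro f g h
    rw [← lie_skew, h, ← lie_skew g f, map_neg, smul_neg]
  -- Non-composable pairs might a priori have composable images under `θ`; preservation of
  -- commutativity excludes this.
  have zero : ∀ f g : IncidenceAlgebra K X, ⁅f, g⁆ = 0 →
      ⁅tau hX x₀ θ σ c κ f, tau hX x₀ θ σ c κ g⁆ = (k : K) • tau hX x₀ θ σ c κ ⁅f, g⁆ := by
    intro f g h
    rw [(hs f g).1 h, h, map_zero, smul_zero]
  refine induction_basis (P := fun f => ⁅tau hX x₀ θ σ c κ f, tau hX x₀ θ σ c κ g⁆ =
    (k : K) • tau hX x₀ θ σ c κ ⁅f, g⁆) (fun p => ?_) (fun z => ?_) ?_ ?_ ?_ f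
  · refine induction_basis (P := fun g => ⁅tau hX x₀ θ σ c κ (eB K p), tau hX x₀ θ σ c κ g⁆ =
      (k : K) • tau hX x₀ θ σ c κ ⁅eB K p, g⁆) (fun q => ?_) (fun z => ?_) ?_ ?_ ?_ g
    · by_cases h : p.1.2 = q.1.1
      · exact tau_bracket_eB_of_composable hX x₀ hτ hc h
      · by_cases h' : q.1.2 = p.1.1
        · exact skew _ _ (tau_bracket_eB_of_composable hX x₀ hτ hc h')
        · exact zero _ _ (bracket_eB_of_not_composable h h')
    · exact skew _ _ (tau_bracket_eD_eB hX x₀ hτ hc z p)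
    · simp
    · intro f g hf hg
      simp only [map_add, lie_add, smul_add, hf, hg]
    · intro a f hf
      simp only [map_smul, lie_smul, hf, smul_comm a]
  · refine induction_basis (P := fun g => ⁅tau hX x₀ θ σ c κ (eD K z), tau hX x₀ θ σ c κ g⁆ =
      (k : K) • tau hX x₀ θ σ c κ ⁅eD K z, g⁆) (fun q => ?_) (fun w => ?_) ?_ ?_ ?_ g
    · exact tau_bracket_eD_eB hX x₀ hτ hc z q
    · exact zero _ _ (diagonal_bracket_diagonal (eD_mem_diagonal z) (eD_mem_diagonal w))
    · simp
    · intro f g hf hg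
      simp only [map_add, lie_add, smul_add, hf, hg]
    · intro a f hf
      simp only [map_smul, lie_smul, hf, smul_comm a]
  · simp
  · intro f g hf hg
    simp only [map_add, add_lie, smul_add, hf, hg]
  · intro a f hf
    simp only [map_smul, smul_lie, hf, smul_comm a]

lemma isOfLieType_shift_comp_tau {φ : IncidenceAlgebra K X →ₗ[K] IncidenceAlgebra K X}
    (hinj : Function.Injective φ) (hcomm : IsStrongCommPreserver φ)
    {α : IncidenceAlgebra K X →ₗ[K] diagonal K X} (hα : IsOfShiftType α)
    (hτ : IsTauData θ σ c κ) (hφ : φ = shift α ∘ₗ tau hX x₀ θ σ c κ) (hcen : IsCentralValued α)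
    {k : Kˣ} (hc : ∀ p, c p = k) : IsOfLieType φ := by
  -- Both `φ` and `S_α` preserve commutativity in both directions, hence so does `τ`.
  have hs : IsStrongCommPreserver (tau hX x₀ θ σ c κ) := fun a b => by
    rw [hcomm a b, hφ]
    exact (hα.strong _ _).symm
  have hτinj : Function.Injective (tau hX x₀ θ σ c κ) := by
    rw [hφ] at hinj
    exact Function.Injective.of_comp (f := shift α) hinj
  have _ : Module.Finite K (IncidenceAlgebra K X) := finite_incidenceAlgebra
  have hinj' : Function.Injective ((k⁻¹ : K) • tau hX x₀ θ σ c κ) := fun a b hab =>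
    hτinj (smul_right_injective _ (inv_ne_zero k.ne_zero) hab)
  let e := LinearEquiv.ofInjectiveEndo _ hinj'
  have he : ∀ f, e f = (k⁻¹ : K) • tau hX x₀ θ σ c κ f := fun f => rfl
  refine ⟨hcomm, k, { e with map_lie' := ?_ },
    (diagonal K X).subtype ∘ₗ α ∘ₗ tau hX x₀ θ σ c κ, k.ne_zero, fun f => hcen _, fun f => ?_⟩
  · intro a b
    change e ⁅a, b⁆ = ⁅e a, e b⁆
    rw [he, he, he, smul_lie, lie_smul, tau_bracket hX x₀ hτ hc hs, smul_smul (k⁻¹ : K) (k : K),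
      inv_mul_cancel₀ k.ne_zero, one_smul]
  · change φ f = (k : K) • e f + (α (tau hX x₀ θ σ c κ f) : IncidenceAlgebra K X)
    rw [he, smul_smul, mul_inv_cancel₀ k.ne_zero, one_smul, hφ]
    rfl

lemma IsCentralValued.isOfShiftType {α : IncidenceAlgebra K X →ₗ[K] diagonal K X}
    (hα : IsCentralValued α) : IsOfShiftType α where
  strong a b := by
    rw [shift_apply, shift_apply, add_lie, lie_add, lie_add,
      bracket_eq_zero_of_mem_center (hα a), bracket_eq_zero_of_mem_center (hα a),
      bracket_eq_zero_of_mem_center' (hα b), add_zero, add_zero, add_zero]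
  bracket_eB p q _ := bracket_eq_zero_of_mem_center (hα _) _
  bracket_eD z p _ := bracket_eq_zero_of_mem_center (hα _) _
  bracket_comm p _ := by
    rw [bracket_eq_zero_of_mem_center (hα _), bracket_eq_zero_of_mem_center' (hα _)]
  bracket_ne p _ := by
    rw [bracket_eq_zero_of_mem_center (hα _)]
    exact (neg_ne_zero.2 (eB_ne_zero p)).symm

lemma sum_eD : ∑ z : X, eD K z = 1 := by
  ext u v _
  have := sum_eD_apply (K := K) (fun _ : X => 1) u v
  simp only [one_smul] at this
  rw [this, IncidenceAlgebra.one_apply]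

/-- A linear map on the incidence algebra with prescribed central values on the basis of the
radical, vanishing on the diagonal. -/
lemma exists_map_of_central (g : LtPair X → IncidenceAlgebra K X)
    (hg : ∀ p, g p ∈ Subalgebra.center K (IncidenceAlgebra K X)) :
    ∃ α : IncidenceAlgebra K X →ₗ[K] diagonal K X, IsCentralValued α ∧
      (∀ p, (α (eB K p) : IncidenceAlgebra K X) = g p) ∧ ∀ z, α (eD K z) = 0 := by
  have _ : Fintype (LtPair X) := Fintype.ofFinite _
  let g' : LtPair X → diagonal K X := fun p => ⟨g p, mem_diagonal_of_mem_center (hg p)⟩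
  let α : IncidenceAlgebra K X →ₗ[K] diagonal K X :=
    ∑ p : LtPair X, (entry p.1.1 p.1.2).smulRight (g' p)
  have happ : ∀ f, α f = ∑ p : LtPair X, f p.1.1 p.1.2 • g' p := fun f => by
    simp [α, LinearMap.sum_apply, entry_apply]
  refine ⟨α, fun f => ?_, fun p => ?_, fun z => ?_⟩
  · rw [happ, Submodule.coe_sum]
    exact sum_mem fun p _ => Subalgebra.smul_mem _ (hg p) _
  · rw [happ, Finset.sum_eq_single p]
    · rw [eB_apply_self, one_smul]
    · intro q _ hq
      rw [eB_apply_of_ne hq.symm, zero_smul]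
    · simp
  · rw [happ]
    refine Finset.sum_eq_zero fun p _ => ?_
    rw [eD_mem_diagonal z _ _ p.2.ne, zero_smul]

lemma IsOfLieType.exists_decomposition {φ : IncidenceAlgebra K X →ₗ[K] IncidenceAlgebra K X}
    (hφ : IsOfLieType φ) (hinj : Function.Injective φ) (hd : IsDiagonalityPreserver φ) :
    ∃ (α : IncidenceAlgebra K X →ₗ[K] diagonal K X)
      (θ : Equiv.Perm (LtPair X)) (σ c : LtPair X → Kˣ) (κ : X → K),
      IsOfShiftType α ∧ IsTauData θ σ c κ ∧ φ = shift α ∘ₗ tau hX x₀ θ σ c κ ∧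
        IsCentralValued α ∧ ∃ k : Kˣ, ∀ p, c p = k := by
  obtain ⟨k, θ, σ, ξ, hξ, hB, hD, hmono, hcompat, hone⟩ := hφ.exists_data hd
  -- These values make `α (τ (e_p)) = ξ (e_p)` on the radical.
  obtain ⟨α, hα, hαB, hαD⟩ := exists_map_of_central
    (fun p => (((σ (θ.symm p))⁻¹ : Kˣ) : K) • ξ (eB K (θ.symm p)))
    fun p => Subalgebra.smul_mem _ (hξ _) _
  have hinc : ∀ z u v, u ⋖ v →
      increment θ (fun _ => k) z u v = φ (eD K z) v v - φ (eD K z) u u := by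
    intro z u v huv
    have h1 := increment_apply θ (fun _ => k) (θ.symm ⟨(u, v), huv.lt⟩) z
    have h2 := hD (θ.symm ⟨(u, v), huv.lt⟩) _ (eD_mem_diagonal z)
    rw [Equiv.apply_symm_apply] at h1 h2
    simp only at h1 h2
    rw [h1]
    linear_combination h2
  refine ⟨α, θ, σ, fun _ => k, fun z => φ (eD K z) x₀ x₀, hα.isOfShiftType,
    ⟨hmono, hcompat, fun _ _ _ _ _ _ => rfl, isAdmissible_of_increment hinc, ?_⟩, ?_, hα,
    k, fun _ => rfl⟩
  -- The sum of `κ` is the entry of `φ 1` at `x₀`. Since `φ 1` is central, a zero there would give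
  -- `φ 1 = 0`, against injectivity.
  · intro h0
    have h1 : φ 1 x₀ x₀ = 0 := by
      rw [← sum_eD, map_sum, ← entry_apply, map_sum]
      exact h0
    have h2 := eq_zero_of_mem_center hX hone h1
    rw [← map_zero φ] at h2
    have h3 := congrArg (fun f : IncidenceAlgebra K X => f x₀ x₀) (hinj h2)
    simp [IncidenceAlgebra.zero_apply] at h3
  · ext1 f
    rw [LinearMap.comp_apply]
    refine induction_basis (P := fun f => φ f = shift α (tau hX x₀ θ σ (fun _ => k) _ f))
      (fun p => ?_) (fun z => ?_) ?_ ?_ ?_ f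
    · rw [tau_eB, map_smul, shift_apply, hαB, hB, Equiv.symm_apply_apply, smul_add, smul_smul,
        Units.mul_inv, one_smul]
    · have h0 : α (tau hX x₀ θ σ (fun _ => k) (fun z => φ (eD K z) x₀ x₀) (eD K z)) = 0 := by
        rw [tau_eD, map_sum]
        exact Finset.sum_eq_zero fun v _ => by rw [map_smul, hαD, smul_zero]
      rw [shift_apply, h0, ZeroMemClass.coe_zero, add_zero]
      ext u v _
      rw [tau_eD_apply]
      split_ifs with h
      · rw [tauDiag_eq_of_increment hX x₀ (fun z => φ (eD K z) x₀ x₀)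
          (g := fun v => φ (eD K z) v v) (hinc z) rfl, h]
      · exact hd _ (eD_mem_diagonal z) u v h
    · rw [map_zero, map_zero, map_zero]
    · intro f g hf hg
      rw [map_add, map_add, map_add, hf, hg]
    · intro a f hf
      rw [map_smul, map_smul, map_smul, hf]

/-- A map that is constant on maximal chains is determined by its values on the pairs that a map
monotone on maximal chains sends to covering pairs. -/
lemma IsConstantOnMaxChains.eq_of_covBy (hc : IsConstantOnMaxChains c)
    (hθ : IsMonotoneOnMaxChains θ) {k : Kˣ}
    (h : ∀ p, (θ p).1.1 ⋖ (θ p).1.2 → c p = k) (p : LtPair X) : c p = k := by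
  obtain ⟨n, u, i, j, hu, hij, rfl⟩ := exists_isMaximalChain_pair p
  -- The first two elements of a maximal chain form a pair whose image is a covering pair, and `c`
  -- has the same value there as at `p`.
  have h0 : (0 : Fin (n + 1)).castSucc < (0 : Fin (n + 1)).succ := Fin.castSucc_lt_succ
  rw [hc n u hu i j hij, ← hc n u hu _ _ h0]
  refine h _ ?_
  rcases hθ _ u hu with ⟨v, hv, hvu⟩ | ⟨v, hv, hvu⟩
  · rw [hvu _ _ h0]
    exact hv.covBy 0
  · rw [hvu _ _ h0, Fin.rev_succ, Fin.rev_castSucc]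
    exact hv.covBy _

lemma IsOfLieType.central_and_constant {φ : IncidenceAlgebra K X →ₗ[K] IncidenceAlgebra K X}
    (hφ : IsOfLieType φ) (hd : IsDiagonalityPreserver φ)
    {α : IncidenceAlgebra K X →ₗ[K] diagonal K X} (hτ : IsTauData θ σ c κ)
    (hdec : φ = shift α ∘ₗ tau hX x₀ θ σ c κ) (hα : ∀ f ∈ diagonal K X, α f = 0) :
    IsCentralValued α ∧ ∃ k : Kˣ, ∀ p, c p = k := by
  obtain ⟨k, θ', σ', ξ, hξ, hB, hD, -⟩ := hφ.exists_data hd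
  have hdecB : ∀ p, φ (eB K p) =
      (σ p : K) • (eB K (θ p) + (α (eB K (θ p)) : IncidenceAlgebra K X)) := fun p => by
    rw [hdec, LinearMap.comp_apply, tau_eB, map_smul, shift_apply]
  -- Both `ξ` and `α` contribute only diagonal entries.
  have hoff : ∀ p, (σ' p : K) • eB K (θ' p) = (σ p : K) • eB K (θ p) := by
    intro p
    have h1 := (hB p).symm.trans (hdecB p)
    ext u v _
    have h2 := congrArg (fun f : IncidenceAlgebra K X => f u v) h1
    simp only [IncidenceAlgebra.add_apply, IncidenceAlgebra.constSMul_apply, smul_eq_mul] at h2 ⊢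
    by_cases huv : u = v
    · rw [huv, eB_apply_diag, eB_apply_diag, mul_zero, mul_zero]
    · rwa [mem_diagonal_of_mem_center (hξ _) u v huv, (α (eB K (θ p))).2 u v huv, add_zero,
        add_zero] at h2
  have hθ : θ' = θ := Equiv.ext fun p => eq_of_smul_eB_eq (Units.ne_zero _) (hoff p)
  subst hθ
  constructor
  · refine induction_basis
      (P := fun f => (α f : IncidenceAlgebra K X) ∈ Subalgebra.center K (IncidenceAlgebra K X))
      (fun q => ?_) (fun z => ?_) ?_ ?_ ?_
    · obtain ⟨p, rfl⟩ := θ'.surjective q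
      have h1 := (hB p).symm.trans (hdecB p)
      rw [hoff, smul_add, add_left_cancel_iff] at h1
      have h2 : (α (eB K (θ' p)) : IncidenceAlgebra K X) =
          (((σ p)⁻¹ : Kˣ) : K) • ξ (eB K p) := by
        rw [h1, smul_smul, Units.inv_mul, one_smul]
      rw [h2]
      exact Subalgebra.smul_mem _ (hξ _) _
    · rw [hα _ (eD_mem_diagonal z)]
      exact zero_mem _
    · rw [map_zero]
      exact zero_mem _
    · intro f g hf hg
      rw [map_add]
      exact add_mem hf hg
    · intro a f hf
      rw [map_smul]
      exact Subalgebra.smul_mem _ hf a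
  -- As `α` vanishes on `D`, `φ` and `τ` agree on `e_x`, where `x` is the lower end of `p`. Across
  -- the covering pair `θ p` the diagonal drops by `c p` according to `τ` and by `k` according to
  -- Lie type.
  · refine ⟨k, hτ.constant.eq_of_covBy hτ.monotone fun p hp => Units.ext ?_⟩
    have h1 := hD p _ (eD_mem_diagonal p.1.1)
    have h2 := hτ.admissible.tauDiag_sub hX x₀ κ hp p.1.1
    have h3 : φ (eD K p.1.1) = tau hX x₀ θ' σ c κ (eD K p.1.1) := by
      rw [hdec, LinearMap.comp_apply, shift_apply, hα _ (tau_eD_mem_diagonal hX x₀ κ σ _)]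
      exact add_zero _
    rw [increment_apply] at h2
    rw [h3, tau_eD_apply, tau_eD_apply, if_pos rfl, if_pos rfl] at h1
    simp only [eD_apply, and_self, p.2.ne', if_true, if_false] at h1 h2
    linear_combination h1 + h2

end LieType

end CommPres

theorem mainTheorem4 {K X : Type*} [Field K] [PartialOrder X] [Fintype X] [DecidableEq X]
    [LocallyFiniteOrder X] [Nontrivial X] (hX : (SimpleGraph.hasse X).Connected) (x₀ : X)
    (φ : IncidenceAlgebra K X →ₗ[K] IncidenceAlgebra K X) (hφ : Function.Bijective φ)
    (hcomm : CommPres.IsStrongCommPreserver φ) (hdiag : CommPres.IsDiagonalityPreserver φ) :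
    (CommPres.IsOfLieType φ ↔
      ∃ (α : IncidenceAlgebra K X →ₗ[K] CommPres.diagonal K X)
        (θ : Equiv.Perm (CommPres.LtPair X)) (σ c : CommPres.LtPair X → Kˣ) (κ : X → K),
        CommPres.IsOfShiftType α ∧ CommPres.IsTauData θ σ c κ ∧
          φ = CommPres.shift α ∘ₗ CommPres.tau hX x₀ θ σ c κ ∧
          CommPres.IsCentralValued α ∧ ∃ k : Kˣ, ∀ p, c p = k) ∧
    (∀ (α : IncidenceAlgebra K X →ₗ[K] CommPres.diagonal K X)
        (θ : Equiv.Perm (CommPres.LtPair X)) (σ c : CommPres.LtPair X → Kˣ) (κ : X → K),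
        CommPres.IsOfShiftType α → CommPres.IsTauData θ σ c κ →
          φ = CommPres.shift α ∘ₗ CommPres.tau hX x₀ θ σ c κ →
          (∀ f ∈ CommPres.diagonal K X, α f = 0) →
          (CommPres.IsOfLieType φ ↔
            (CommPres.IsCentralValued α ∧ ∃ k : Kˣ, ∀ p, c p = k))) := by
  refine ⟨⟨fun h => h.exists_decomposition hX x₀ hφ.1 hdiag, ?_⟩, ?_⟩
  · rintro ⟨α, θ, σ, c, κ, hα, hτ, hdec, hcen, k, hk⟩
    exact CommPres.isOfLieType_shift_comp_tau hX x₀ hφ.1 hcomm hα hτ hdec hcen hk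
  · intro α θ σ c κ hα hτ hdec hαD
    refine ⟨fun h => h.central_and_constant hX x₀ hdiag hτ hdec hαD, ?_⟩
    rintro ⟨hcen, k, hk⟩
    exact CommPres.isOfLieType_shift_comp_tau hX x₀ hφ.1 hcomm hα hτ hdec hcen hk
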